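/- Consider a discrete memoryless two-user multiple access channel with finite input alphabets $\mathcal X_1,\mathcal X_2$, finite state alphabets $\mathcal S_1,\mathcal S_2$ and finite output alphabet $\mathcal Y$, given by a transition law $P(y|x_1,x_2,s_1,s_2)$ and a joint state law $P(s_1,s_2)$. In $n$ channel uses the state pairs $(S_{1,i},S_{2,i})$ are i.i.d. with law $P(s_1,s_2)$ and the channel is memoryless, that is, $P(\mathbf y|\mathbf x_1,\mathbf x_2,\mathbf s_1,\mathbf s_2)=\prod_{i=1}^n P(y_i|x_{1,i},x_{2,i},s_{1,i},s_{2,i})$. The messages $m_1\in\{1,\dots,M_1\}$ and $m_2\in\{1,\dots,M_2\}$ are independent of each other and of the states, and uniform. A code of length $n$ consists of encoders $\phi_k:\{1,\dots,M_k\}\times\mathcal S_k^n\to\mathcal X_k^n$, $k=1,2$ (encoder $k$ knows the whole sequence $\mathbf s_k$ non-causally), and a decoder $\psi:\mathcal Y^n\to\{1,\dots,M_1\}\times\{1,\dots,M_2\}$; its error probability is $P_e^{(n)}=\Pr(\psi(\mathbf y)\ne(m_1,m_2))$. A pair $(R_1,R_2)$ of nonnegative reals is achievable if there are codes of all lengths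 $n$ with $M_k=\lceil 2^{nR_k}\rceil$, $k=1,2$, and $P_e^{(n)}\to0$ as $n\to\infty$. The capacity region is the closure of the set of achievable pairs. Call a pair $(U,V)$ of auxiliary random variables with finite alphabets admissible if $$P(u,v,x_1,x_2,s_1,s_2,y)=P(s_1,s_2)\,P(u,x_1|s_1)\,P(v,x_2|s_2)\,P(y|x_1,x_2,s_1,s_2)$$ for some conditional laws $P(u,x_1|s_1)$ and $P(v,x_2|s_2)$. Let $\mathcal R\subseteq\mathbb R^2$ be the closure of the convex hull of the set of all $(R_1,R_2)\in\mathbb R^2$ such that, for some admissible pair $(U,V)$, with all informations in bits, \begin{align*} R_1&\le I(U;Y|V)-I(U;S_1|V),\\ R_2&\le I(V;Y|U)-I(V;S_2|U),\\ R_1+R_2&\le I(U,V;Y)-I(U,V;S_1,S_2). \end{align*} Theorem. $\mathcal R$ is an inner bound for the capacity region: every $(R_1,R_2)\in\mathcal R$ with $R_1\ge0$ and $R_2\ge0$ belongs to the capacity region. -/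

import Mathlib

noncomputable section

/-! ### Information measures of finite random variables, in bits -/

section Information

variable {Ω α β γ : Type*} [Fintype Ω] [Fintype α] [Fintype β] [Fintype γ]

open Classical in
/-- The law of the random variable `f` on the finite probability space `(Ω, p)`:
`law p f a` is the probability that `f = a`. -/
def law (p : Ω → ℝ) (f : Ω → α) (a : α) : ℝ :=
  ∑ ω, if f ω = a then p ω else 0

/-- Mutual information `I(f ; g) = ∑ p(a,b) log₂ (p(a,b) / (p(a) p(b)))`.
Terms with `p(a,b) = 0` vanish; when `p(a,b) > 0` the denominator is positive. -/
def mutualInfo (p : Ω → ℝ) (f : Ω → α) (g : Ω → β) : ℝ :=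
  ∑ a, ∑ b, law p (fun ω => (f ω, g ω)) (a, b) *
    Real.logb 2 (law p (fun ω => (f ω, g ω)) (a, b) / (law p f a * law p g b))

/-- Conditional mutual information
`I(f ; g | h) = ∑ p(a,b,c) log₂ (p(a,b|c) / (p(a|c) p(b|c)))`, where the quotient is written as
`p(a,b,c) p(c) / (p(a,c) p(b,c))`. -/
def condMutualInfo (p : Ω → ℝ) (f : Ω → α) (g : Ω → β) (h : Ω → γ) : ℝ :=
  ∑ a, ∑ b, ∑ c, law p (fun ω => (f ω, g ω, h ω)) (a, b, c) *
    Real.logb 2 (law p (fun ω => (f ω, g ω, h ω)) (a, b, c) * law p h c /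
      (law p (fun ω => (f ω, h ω)) (a, c) * law p (fun ω => (g ω, h ω)) (b, c)))

end Information

/-! ### The channel and its block codes -/

/-- A discrete memoryless two-user multiple access channel `P(y | x₁, x₂, s₁, s₂)` together with
the joint law `P(s₁, s₂)` of its pair of states; all alphabets are finite. -/
structure StateMAC (S₁ S₂ X₁ X₂ Y : Type*) [Fintype S₁] [Fintype S₂] [Fintype Y] where
  /-- the state law `P(s₁, s₂)` -/
  state : S₁ × S₂ → ℝ
  state_mem : state ∈ stdSimplex ℝ (S₁ × S₂)
  /-- the transition law `P(y | x₁, x₂, s₁, s₂)` -/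
  trans : X₁ → X₂ → S₁ → S₂ → Y → ℝ
  trans_mem : ∀ x₁ x₂ s₁ s₂, trans x₁ x₂ s₁ s₂ ∈ stdSimplex ℝ Y

/-- A block code of length `n` with `M₁` and `M₂` messages. Encoder `k` knows its message and the
whole state sequence `s_k` (non-causally) and nothing else; the decoder knows only the output
sequence. -/
structure MACCode (S₁ S₂ X₁ X₂ Y : Type*) (n M₁ M₂ : ℕ) where
  enc₁ : Fin M₁ → (Fin n → S₁) → (Fin n → X₁)
  enc₂ : Fin M₂ → (Fin n → S₂) → (Fin n → X₂)
  dec : (Fin n → Y) → Fin M₁ × Fin M₂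

namespace StateMAC

variable {S₁ S₂ X₁ X₂ Y : Type*} [Fintype S₁] [Fintype S₂] [Fintype Y]

/-- The error probability `Pr(ψ(Y) ≠ (m₁, m₂))`: the messages are independent and uniform, the
state pairs are i.i.d. with law `P(s₁, s₂)`, and the channel is memoryless. -/
def errorProb (W : StateMAC S₁ S₂ X₁ X₂ Y) {n M₁ M₂ : ℕ} (c : MACCode S₁ S₂ X₁ X₂ Y n M₁ M₂) : ℝ :=
  ∑ m₁ : Fin M₁, ∑ m₂ : Fin M₂, ∑ s₁ : Fin n → S₁, ∑ s₂ : Fin n → S₂, ∑ y : Fin n → Y,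
    (1 / (M₁ : ℝ)) * (1 / (M₂ : ℝ)) * (∏ i, W.state (s₁ i, s₂ i)) *
      (∏ i, W.trans (c.enc₁ m₁ s₁ i) (c.enc₂ m₂ s₂ i) (s₁ i) (s₂ i) (y i)) *
      (if c.dec y = (m₁, m₂) then 0 else 1)

/-- The rate pair `(R₁, R₂)` of nonnegative reals is achievable: there are codes of all block
lengths `n` with `⌈2 ^ (n R₁)⌉` and `⌈2 ^ (n R₂)⌉` messages whose error probability tends to `0`. -/
def Achievable (W : StateMAC S₁ S₂ X₁ X₂ Y) (R : ℝ × ℝ) : Prop :=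
  0 ≤ R.1 ∧ 0 ≤ R.2 ∧
    ∃ c : ∀ n : ℕ, MACCode S₁ S₂ X₁ X₂ Y n
        ⌈(2 : ℝ) ^ ((n : ℝ) * R.1)⌉₊ ⌈(2 : ℝ) ^ ((n : ℝ) * R.2)⌉₊,
      Filter.Tendsto (fun n => W.errorProb (c n)) Filter.atTop (nhds 0)

/-- The capacity region: the closure of the set of achievable rate pairs. -/
def capacityRegion (W : StateMAC S₁ S₂ X₁ X₂ Y) : Set (ℝ × ℝ) :=
  closure {R | W.Achievable R}

/-! ### Admissible pairs and the inner bound -/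

/-- The choice of an admissible pair `(U, V)` with finite alphabets `U` and `V`: the two conditional
laws `P(u, x₁ | s₁)` and `P(v, x₂ | s₂)`. -/
structure AdmissiblePair (S₁ S₂ X₁ X₂ U V : Type*)
    [Fintype X₁] [Fintype X₂] [Fintype U] [Fintype V] where
  kernel₁ : S₁ → U × X₁ → ℝ
  kernel₁_mem : ∀ s₁, kernel₁ s₁ ∈ stdSimplex ℝ (U × X₁)
  kernel₂ : S₂ → V × X₂ → ℝ
  kernel₂_mem : ∀ s₂, kernel₂ s₂ ∈ stdSimplex ℝ (V × X₂)

section Region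

variable [Fintype X₁] [Fintype X₂] {U V : Type*} [Fintype U] [Fintype V]

/-- The joint law
`P(u, v, x₁, x₂, s₁, s₂, y) = P(s₁, s₂) P(u, x₁ | s₁) P(v, x₂ | s₂) P(y | x₁, x₂, s₁, s₂)`. -/
def jointLaw (W : StateMAC S₁ S₂ X₁ X₂ Y) (a : AdmissiblePair S₁ S₂ X₁ X₂ U V) :
    U × V × X₁ × X₂ × S₁ × S₂ × Y → ℝ :=
  fun (u, v, x₁, x₂, s₁, s₂, y) =>
    W.state (s₁, s₂) * a.kernel₁ s₁ (u, x₁) * a.kernel₂ s₂ (v, x₂) * W.trans x₁ x₂ s₁ s₂ y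

/-- The pairs `(R₁, R₂)` that satisfy the three rate constraints for the admissible pair `a`. -/
def rateConstraints (W : StateMAC S₁ S₂ X₁ X₂ Y) (a : AdmissiblePair S₁ S₂ X₁ X₂ U V) :
    Set (ℝ × ℝ) :=
  let P := W.jointLaw a
  let u : U × V × X₁ × X₂ × S₁ × S₂ × Y → U := fun (u, _, _, _, _, _, _) => u
  let v : U × V × X₁ × X₂ × S₁ × S₂ × Y → V := fun (_, v, _, _, _, _, _) => v
  let s₁ : U × V × X₁ × X₂ × S₁ × S₂ × Y → S₁ := fun (_, _, _, _, s₁, _, _) => s₁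
  let s₂ : U × V × X₁ × X₂ × S₁ × S₂ × Y → S₂ := fun (_, _, _, _, _, s₂, _) => s₂
  let y : U × V × X₁ × X₂ × S₁ × S₂ × Y → Y := fun (_, _, _, _, _, _, y) => y
  {R | R.1 ≤ condMutualInfo P u y v - condMutualInfo P u s₁ v ∧
    R.2 ≤ condMutualInfo P v y u - condMutualInfo P v s₂ u ∧
    R.1 + R.2 ≤ mutualInfo P (fun ω => (u ω, v ω)) y -
      mutualInfo P (fun ω => (u ω, v ω)) (fun ω => (s₁ ω, s₂ ω))}

/-- The inner bound: the closure of the convex hull of all pairs that satisfy the rate constraints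
for some admissible pair `(U, V)`. The alphabets of `U` and `V` are arbitrary finite sets, that is,
up to a relabelling, `Fin k` and `Fin l`. -/
def innerBound (W : StateMAC S₁ S₂ X₁ X₂ Y) : Set (ℝ × ℝ) :=
  closure (convexHull ℝ {R | ∃ (k l : ℕ) (a : AdmissiblePair S₁ S₂ X₁ X₂ (Fin k) (Fin l)),
    R ∈ W.rateConstraints a})

end Region

end StateMAC

end

noncomputable section

/-! ### Sums over product spaces and random codebooks -/

section Codebook

/-! The scheme is Gelfand–Pinsker binning at both encoders, without typicality. Each message of user
`k` owns a bin of `L_k` random codewords. Encoder 1 picks a codeword of its bin with probability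
proportional to `P(u|s₁)/Q₁(u)` and draws its input from `P(x₁|u,s₁)`; encoder 2 acts likewise. The
decoder picks a message pair with probability proportional to the total `P(u,v,y)` of its codeword
pairs. Success is linear in each of these three randomised maps, so deterministic maps do as well
(`exists_deterministic`).

For random codebooks the success probability is a mean of quotients with random denominators. The
reciprocal of a product lies above its tangent (`tangent_le_inv_mul`), which is affine in the
denominators, so only their conditional means given the transmitted codewords matter
(`le_codebookMean_success`). The resulting bound on the error splits into five moments of likelihood
ratios (`exists_code_error_le`): one per user for finding a suitable codeword in the bin, and three
for competitors in which the first, the second, or both codewords differ from the transmitted ones.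

On product laws these moments factor. For a convex combination, the admissible pair used at each
time is drawn i.i.d. from the weights; the mean over schedules turns each moment into an `n`-th
power, and some fixed schedule is at least as good (`exists_code_errorProb_le`). If the prefactor
grows like `2^(nc)`, the base is `2^(ct) E[r^t]`, which is 1 at `t = 0` with slope proportional to
`E[log₂ r] + c`; when this is negative, a small `t` gives exponential decay
(`exists_rpow_moment_lt_one`). The mean log-ratios add up to minus the three information differences
(`rate_sub₁`, `rate_sub₂`, `rate_sub`), so bins slightly larger than necessary leave room for all
rates strictly below the three bounds.

A zero rate means a single message, which has no competitor, so its individual bound can be dropped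
(`achievable_of_lt`). This handles boundary points of the quadrant, near which the hull may only
offer points with a negative coordinate. -/

theorem sum_pi_prod {ι : Type*} [Fintype ι] [DecidableEq ι] {A : ι → Type*} [∀ i, Fintype (A i)]
    (g : ∀ i, A i → ℝ) : ∑ f : (∀ i, A i), ∏ i, g i (f i) = ∏ i, ∑ a, g i a := by
  rw [Finset.prod_univ_sum, Fintype.piFinset_univ]

variable {ι U : Type*} [Fintype ι] [DecidableEq ι] [Fintype U]

/-- The expectation of `F` over a codebook whose codewords are independent with law `Q`. -/
def codebookMean (Q : U → ℝ) (F : (ι → U) → ℝ) : ℝ :=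
  ∑ u : ι → U, (∏ i, Q (u i)) * F u

variable {Q : U → ℝ}

theorem codebookMean_const (hQ : ∑ a, Q a = 1) (c : ℝ) :
    codebookMean (ι := ι) Q (fun _ => c) = c := by
  unfold codebookMean
  rw [← Finset.sum_mul, sum_pi_prod (fun _ : ι => Q)]
  simp [hQ]

theorem codebookMean_add (F G : (ι → U) → ℝ) :
    codebookMean Q (fun u => F u + G u) = codebookMean Q F + codebookMean Q G := by
  simp [codebookMean, mul_add, Finset.sum_add_distrib]

theorem codebookMean_sub (F G : (ι → U) → ℝ) :
    codebookMean Q (fun u => F u - G u) = codebookMean Q F - codebookMean Q G := by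
  simp [codebookMean, mul_sub, Finset.sum_sub_distrib]

theorem codebookMean_mul_left (c : ℝ) (F : (ι → U) → ℝ) :
    codebookMean Q (fun u => c * F u) = c * codebookMean Q F := by
  simp only [codebookMean, Finset.mul_sum]
  exact Finset.sum_congr rfl fun _ _ => by ring

theorem codebookMean_div (c : ℝ) (F : (ι → U) → ℝ) :
    codebookMean Q (fun u => F u / c) = codebookMean Q F / c := by
  simp only [div_eq_inv_mul, codebookMean_mul_left]

theorem codebookMean_sum {κ : Type*} (s : Finset κ) (F : κ → (ι → U) → ℝ) :
    codebookMean Q (fun u => ∑ k ∈ s, F k u) = ∑ k ∈ s, codebookMean Q (F k) := by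
  simp only [codebookMean, Finset.mul_sum]
  exact Finset.sum_comm

theorem codebookMean_mono (hQ : ∀ a, 0 ≤ Q a) {F G : (ι → U) → ℝ} (h : ∀ u, F u ≤ G u) :
    codebookMean Q F ≤ codebookMean Q G :=
  Finset.sum_le_sum fun u _ =>
    mul_le_mul_of_nonneg_left (h u) (Finset.prod_nonneg fun i _ => hQ (u i))

/-- Some codebook is at least as good as the average. -/
theorem exists_codebookMean_le (hQ : ∀ a, 0 ≤ Q a) (hQ1 : ∑ a, Q a = 1) (F : (ι → U) → ℝ) :
    ∃ u, codebookMean Q F ≤ F u := by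
  by_contra! h
  have h1 : codebookMean Q F < codebookMean Q (fun _ : ι → U => codebookMean Q F) := by
    have hs : ∑ u : ι → U, ∏ i, Q (u i) = 1 := by
      rw [sum_pi_prod (fun _ : ι => Q)]; simp [hQ1]
    -- Strictness of the averaged inequality needs a codebook of positive probability.
    obtain ⟨u, -, hu⟩ : ∃ u ∈ (Finset.univ : Finset (ι → U)), ∏ i, Q (u i) ≠ 0 :=
      Finset.exists_ne_zero_of_sum_ne_zero (by rw [hs]; norm_num)
    have hp : ∀ u : ι → U, 0 ≤ ∏ i, Q (u i) := fun u => Finset.prod_nonneg fun i _ => hQ (u i)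
    refine Finset.sum_lt_sum (fun v _ => mul_le_mul_of_nonneg_left (h v).le (hp v))
      ⟨u, Finset.mem_univ _, mul_lt_mul_of_pos_left (h u) ((hp u).lt_of_ne' hu)⟩
  rw [codebookMean_const hQ1] at h1
  exact lt_irrefl _ h1

/-- Resampling one codeword does not change the expectation. -/
theorem codebookMean_update (hQ : ∑ a, Q a = 1) (k : ι) (F : (ι → U) → ℝ) :
    codebookMean Q F = ∑ a, Q a * codebookMean Q (fun u => F (Function.update u k a)) := by
  -- Coordinate `k` is split off; after the update nothing depends on its old value, whose weights
  -- sum to 1.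
  have key : ∀ G : (ι → U) → ℝ, codebookMean Q G =
      ∑ b, Q b * ∑ r : {j // j ≠ k} → U, (∏ j, Q (r j)) *
        G ((Equiv.funSplitAt k U).symm (b, r)) := by
    intro G
    unfold codebookMean
    rw [← (Equiv.funSplitAt k U).symm.sum_comp, Fintype.sum_prod_type]
    refine Finset.sum_congr rfl fun b _ => ?_
    rw [Finset.mul_sum]
    refine Finset.sum_congr rfl fun r _ => ?_
    rw [Fintype.prod_eq_mul_prod_subtype_ne _ k, ← mul_assoc]
    congr 2
    · simp [Equiv.funSplitAt, Equiv.piSplitAt]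
    · refine Finset.prod_congr rfl fun j _ => ?_
      have := j.2
      simp [Equiv.funSplitAt, Equiv.piSplitAt, this]
  rw [key]
  refine Finset.sum_congr rfl fun a _ => ?_
  rw [key]
  have h2 : ∀ b (r : {j // j ≠ k} → U), Function.update ((Equiv.funSplitAt k U).symm (b, r)) k a =
      (Equiv.funSplitAt k U).symm (a, r) := by
    intro b r
    ext j
    by_cases hj : j = k
    · subst hj; simp [Equiv.funSplitAt, Equiv.piSplitAt]
    · simp [Equiv.funSplitAt, Equiv.piSplitAt, hj]
  simp only [h2]
  rw [← Finset.sum_mul, hQ, one_mul]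

theorem codebookMean_eval (hQ : ∑ a, Q a = 1) (k : ι) (g : U → ℝ) :
    codebookMean Q (fun u => g (u k)) = ∑ a, Q a * g a := by
  rw [codebookMean_update hQ k]
  simp [codebookMean_const hQ]

theorem codebookMean_update_eval (hQ : ∑ a, Q a = 1) (k l : ι) (a : U) (g : U → ℝ) :
    codebookMean Q (fun u => g (Function.update u k a l)) =
      if l = k then g a else ∑ b, Q b * g b := by
  split_ifs with h
  · subst h; simp [codebookMean_const hQ]
  · simp [Function.update_of_ne h, codebookMean_eval hQ]

end Codebook

/-! ### Replacing randomised maps by deterministic ones -/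

section Derandomisation

/-- Pointwise in `a`, a weighted mean is at most the maximum. Total weight at most one suffices
because the rewards are nonnegative. -/
theorem exists_sum_mul_le_sum {A X : Type*} [Fintype A] [Fintype X] [Nonempty X]
    (E c : A → X → ℝ) (hE : ∀ a x, 0 ≤ E a x) (hE1 : ∀ a, ∑ x, E a x ≤ 1)
    (hc : ∀ a x, 0 ≤ c a x) :
    ∃ f : A → X, ∑ a, ∑ x, E a x * c a x ≤ ∑ a, c a (f a) := by
  choose f hf using fun a => Finite.exists_max (c a)
  refine ⟨f, Finset.sum_le_sum fun a _ => ?_⟩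
  calc ∑ x, E a x * c a x ≤ ∑ x, E a x * c a (f a) :=
        Finset.sum_le_sum fun x _ => mul_le_mul_of_nonneg_left (hf a x) (hE a x)
    _ = (∑ x, E a x) * c a (f a) := by rw [Finset.sum_mul]
    _ ≤ c a (f a) := mul_le_of_le_one_left (hc _ _) (hE1 a)

/-- Three randomised maps with a nonnegative multilinear reward can be replaced by deterministic
ones. -/
theorem exists_deterministic {A B C X Z W : Type*} [Fintype A] [Fintype B] [Fintype C]
    [Fintype X] [Fintype Z] [Fintype W] [Nonempty X] [Nonempty Z] [Nonempty W]
    (E₁ : A → X → ℝ) (E₂ : B → Z → ℝ) (D : C → W → ℝ) (c : A → X → B → Z → C → W → ℝ)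
    (h₁ : ∀ a x, 0 ≤ E₁ a x) (h₁' : ∀ a, ∑ x, E₁ a x ≤ 1)
    (h₂ : ∀ b z, 0 ≤ E₂ b z) (h₂' : ∀ b, ∑ z, E₂ b z ≤ 1)
    (hD : ∀ y w, 0 ≤ D y w) (hD' : ∀ y, ∑ w, D y w ≤ 1)
    (hc : ∀ a x b z y w, 0 ≤ c a x b z y w) :
    ∃ (f : A → X) (g : B → Z) (h : C → W),
      ∑ a, ∑ x, E₁ a x * ∑ b, ∑ z, E₂ b z * ∑ y, ∑ w, D y w * c a x b z y w ≤
        ∑ a, ∑ b, ∑ y, c a (f a) b (g b) y (h y) := by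
  -- The maps are fixed one at a time; with the others held, the reward is linear in the current
  -- one, so each choice depends only on that map's own argument.
  obtain ⟨f, hf⟩ := exists_sum_mul_le_sum E₁
    (fun a x => ∑ b, ∑ z, E₂ b z * ∑ y, ∑ w, D y w * c a x b z y w) h₁ h₁'
    (fun a x => Finset.sum_nonneg fun b _ => Finset.sum_nonneg fun z _ => mul_nonneg (h₂ b z) <|
      Finset.sum_nonneg fun y _ => Finset.sum_nonneg fun w _ => mul_nonneg (hD y w) (hc ..))
  obtain ⟨g, hg⟩ := exists_sum_mul_le_sum E₂
    (fun b z => ∑ a, ∑ y, ∑ w, D y w * c a (f a) b z y w) h₂ h₂'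
    (fun a x => Finset.sum_nonneg fun b _ =>
      Finset.sum_nonneg fun y _ => Finset.sum_nonneg fun w _ => mul_nonneg (hD y w) (hc ..))
  obtain ⟨h, hh⟩ := exists_sum_mul_le_sum D
    (fun y w => ∑ a, ∑ b, c a (f a) b (g b) y w) hD hD'
    (fun a x => Finset.sum_nonneg fun b _ => Finset.sum_nonneg fun y _ => hc ..)
  refine ⟨f, g, h, hf.trans ?_⟩
  have e1 : ∑ a, ∑ b, ∑ z, E₂ b z * ∑ y, ∑ w, D y w * c a (f a) b z y w =
      ∑ b, ∑ z, E₂ b z * ∑ a, ∑ y, ∑ w, D y w * c a (f a) b z y w := by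
    rw [Finset.sum_comm]
    refine Finset.sum_congr rfl fun b _ => ?_
    rw [Finset.sum_comm]
    exact Finset.sum_congr rfl fun z _ => (Finset.mul_sum ..).symm
  have e2 : ∑ b, ∑ a, ∑ y, ∑ w, D y w * c a (f a) b (g b) y w =
      ∑ y, ∑ w, D y w * ∑ a, ∑ b, c a (f a) b (g b) y w := by
    simp only [Finset.mul_sum]
    rw [Finset.sum_comm]
    calc _ = ∑ a, ∑ y, ∑ w, ∑ b, D y w * c a (f a) b (g b) y w := by
          refine Finset.sum_congr rfl fun a _ => ?_
          rw [Finset.sum_comm]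
          exact Finset.sum_congr rfl fun y _ => Finset.sum_comm
      _ = _ := by
          rw [Finset.sum_comm]
          exact Finset.sum_congr rfl fun y _ => Finset.sum_comm
  have e3 : ∑ y, ∑ a, ∑ b, c a (f a) b (g b) y (h y) =
      ∑ a, ∑ b, ∑ y, c a (f a) b (g b) y (h y) := by
    rw [Finset.sum_comm]
    exact Finset.sum_congr rfl fun a _ => Finset.sum_comm
  rw [e1]
  refine hg.trans ?_
  rw [e2]
  exact hh.trans e3.le

end Derandomisation


/-! ### The one-shot random coding bound -/

section OneShot

/-- Jensen's inequality for `1 / (xyz)` in tangent form. -/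
theorem tangent_le_inv_mul {x y z : ℝ} (hx : 0 < x) (hy : 0 < y) (hz : 0 < z) :
    4 - x - y - z ≤ 1 / (x * y * z) := by
  have h1 : ∀ t : ℝ, 0 < t → 1 - t ≤ - Real.log t := fun t ht => by
    linarith [Real.log_le_sub_one_of_pos ht]
  have hp : 0 < 1 / (x * y * z) := by positivity
  have h2 := Real.log_le_sub_one_of_pos hp
  rw [one_div, Real.log_inv, Real.log_mul (by positivity) hz.ne', Real.log_mul hx.ne' hy.ne'] at h2
  rw [one_div]
  linarith [h1 x hx, h1 y hy, h1 z hz]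

/-- Monotonicity of `t / (t + W)`: the decoder may be credited with a single codeword pair of the
right bins instead of all of them. -/
theorem div_add_div_add_le {N W d : ℝ} (hd : 0 ≤ d) (hW : 0 ≤ W) (hN : d ≤ N) :
    d / (d + W) ≤ N / (N + W) := by
  rcases hd.eq_or_lt with rfl | hd
  · simp; positivity
  · rw [div_le_div_iff₀ (by linarith) (by linarith)]
    nlinarith

variable {U V : Type*} [Fintype U] [Fintype V]

theorem sum_ne_fst {M L : ℕ} (m : Fin M) (c : ℝ) :
    (∑ k : Fin M × Fin L, if k.1 ≠ m then c else 0) = ((M : ℝ) - 1) * L * c := by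
  rw [Fintype.sum_prod_type]
  have : ∀ x : Fin M, (∑ _y : Fin L, if x ≠ m then c else 0) =
      (L : ℝ) * c - if x = m then (L : ℝ) * c else 0 := by
    intro x; split_ifs <;> simp_all
  simp only [this, Finset.sum_sub_distrib, Finset.sum_ite_eq', Finset.mem_univ, if_true]
  simp; ring

/-- The indicator of a wrong pair is one minus a product of two indicators, so the double sum
factors. -/
theorem sum_ne_pair {M₁ L₁ M₂ L₂ : ℕ} (m₁ : Fin M₁) (m₂ : Fin M₂) (c : ℝ) :
    (∑ k : Fin M₁ × Fin L₁, ∑ k' : Fin M₂ × Fin L₂,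
      if (k.1, k'.1) ≠ (m₁, m₂) then c else 0) =
      ((M₁ : ℝ) * M₂ - 1) * L₁ * L₂ * c := by
  have h : ∀ (k : Fin M₁ × Fin L₁) (k' : Fin M₂ × Fin L₂),
      (if (k.1, k'.1) ≠ (m₁, m₂) then c else 0) =
        c - (if k.1 = m₁ then 1 else 0) * ((if k'.1 = m₂ then 1 else 0) * c) := by
    intro k k'
    by_cases h1 : k.1 = m₁ <;> by_cases h2 : k'.1 = m₂ <;> simp [h1, h2]
  have h' : ∀ {M L : ℕ} (m : Fin M), (∑ k : Fin M × Fin L, if k.1 = m then (1 : ℝ) else 0) = L := by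
    intro M L m
    rw [Fintype.sum_prod_type, Finset.sum_comm]
    simp
  simp only [h, Finset.sum_sub_distrib, ← Finset.mul_sum, ← Finset.sum_mul, h']
  simp; ring

/-- The mean total decoding metric of the competitors of a codeword pair with metric `d a b`. -/
def confusion (M₁ M₂ L₁ L₂ : ℕ) (Q₁ : U → ℝ) (Q₂ : V → ℝ) (d : U → V → ℝ) (a : U) (b : V) : ℝ :=
  ((M₁ : ℝ) - 1) * L₁ * (∑ a', Q₁ a' * d a' b) + ((M₂ : ℝ) - 1) * L₂ * (∑ b', Q₂ b' * d a b') +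
    ((M₁ : ℝ) * M₂ - 1) * L₁ * L₂ * (∑ a', Q₁ a' * ∑ b', Q₂ b' * d a' b')

variable {M₁ M₂ L₁ L₂ : ℕ} {Q₁ : U → ℝ} {Q₂ : V → ℝ}

theorem confusion_nonneg (hM₁ : 0 < M₁) (hM₂ : 0 < M₂) (hQ₁ : ∀ a, 0 ≤ Q₁ a) (hQ₂ : ∀ b, 0 ≤ Q₂ b)
    {d : U → V → ℝ} (hd : ∀ a b, 0 ≤ d a b) (a : U) (b : V) :
    0 ≤ confusion M₁ M₂ L₁ L₂ Q₁ Q₂ d a b := by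
  have h1 : (0 : ℝ) ≤ (M₁ : ℝ) - 1 := by
    rw [sub_nonneg]; exact_mod_cast hM₁
  have h2 : (0 : ℝ) ≤ (M₂ : ℝ) - 1 := by
    rw [sub_nonneg]; exact_mod_cast hM₂
  have h3 : (0 : ℝ) ≤ (M₁ : ℝ) * M₂ - 1 := by nlinarith
  have e1 : 0 ≤ ∑ a', Q₁ a' * d a' b := Finset.sum_nonneg fun _ _ => mul_nonneg (hQ₁ _) (hd ..)
  have e2 : 0 ≤ ∑ b', Q₂ b' * d a b' := Finset.sum_nonneg fun _ _ => mul_nonneg (hQ₂ _) (hd ..)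
  have e3 : 0 ≤ ∑ a', Q₁ a' * ∑ b', Q₂ b' * d a' b' := Finset.sum_nonneg fun _ _ =>
    mul_nonneg (hQ₁ _) (Finset.sum_nonneg fun _ _ => mul_nonneg (hQ₂ _) (hd ..))
  unfold confusion
  positivity

/-- The total decoding metric of the codeword pairs that carry other messages than `(m₁, m₂)`. -/
def wrongMetric (d : U → V → ℝ) (m₁ : Fin M₁) (m₂ : Fin M₂)
    (u : Fin M₁ × Fin L₁ → U) (v : Fin M₂ × Fin L₂ → V) : ℝ :=
  ∑ k, ∑ k', if (k.1, k'.1) ≠ (m₁, m₂) then d (u k) (v k') else 0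

/-- The total decoding metric of the codeword pairs that carry the messages `(m₁, m₂)`. -/
def messageMetric (d : U → V → ℝ) (m₁ : Fin M₁) (m₂ : Fin M₂)
    (u : Fin M₁ × Fin L₁ → U) (v : Fin M₂ × Fin L₂ → V) : ℝ :=
  ∑ l, ∑ l', d (u (m₁, l)) (v (m₂, l'))

theorem sum_eq_messageMetric_add_wrongMetric {U V : Type*} (d : U → V → ℝ) (m₁ : Fin M₁) (m₂ : Fin M₂)
    (u : Fin M₁ × Fin L₁ → U) (v : Fin M₂ × Fin L₂ → V) :
    ∑ k, ∑ k', d (u k) (v k') = messageMetric d m₁ m₂ u v + wrongMetric d m₁ m₂ u v := by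
  have h : messageMetric d m₁ m₂ u v =
      ∑ k, ∑ k', if (k.1, k'.1) = (m₁, m₂) then d (u k) (v k') else 0 := by
    simp only [messageMetric, Fintype.sum_prod_type, Prod.mk.injEq]
    rw [Finset.sum_eq_single m₁ (fun b _ hb => by simp [hb]) (by simp)]
    refine Finset.sum_congr rfl fun l _ => ?_
    rw [Finset.sum_eq_single m₂ (fun b _ hb => by simp [hb]) (by simp)]
    simp
  rw [h, wrongMetric, ← Finset.sum_add_distrib]
  refine Finset.sum_congr rfl fun k _ => ?_
  rw [← Finset.sum_add_distrib]
  refine Finset.sum_congr rfl fun k' _ => ?_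
  split_ifs <;> simp_all

/-- Given that codeword `l` equals `a`, the other codewords of the bin are fresh, each with mean
weight at most 1; their number `L₁ - 1` is rounded up to `L₁`. -/
theorem codebookMean_likelihood_le (hQ₁ : ∑ a, Q₁ a = 1) {w : U → ℝ}
    (hw1 : ∑ a, Q₁ a * w a ≤ 1) (m : Fin M₁) (l : Fin L₁) (a : U) :
    codebookMean Q₁ (fun u => ∑ l', w (Function.update u (m, l) a (m, l'))) ≤ w a + L₁ := by
  rw [codebookMean_sum]
  simp only [codebookMean_update_eval hQ₁]
  calc _ ≤ ∑ l' : Fin L₁, ((if l' = l then w a else 0) + 1) := by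
        refine Finset.sum_le_sum fun l' _ => ?_
        by_cases h : l' = l
        · simp [h]
        · simpa [h] using hw1
    _ = w a + L₁ := by simp [Finset.sum_add_distrib]

/-- A competitor with a wrong message pair shares at most one codeword with the transmitted pair,
and its remaining codewords are fresh. Sharing the second forces a wrong first message, and
conversely. Every wrong pair, including those that share a codeword, is also charged to the class
with two fresh codewords; the overcount is harmless by nonnegativity. -/
theorem codebookMean_wrongMetric_le (hQ₁ : ∀ a, 0 ≤ Q₁ a) (hQ₁' : ∑ a, Q₁ a = 1)
    (hQ₂ : ∀ b, 0 ≤ Q₂ b) (hQ₂' : ∑ b, Q₂ b = 1) {d : U → V → ℝ} (hd : ∀ a b, 0 ≤ d a b)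
    (m₁ : Fin M₁) (l₁ : Fin L₁) (m₂ : Fin M₂) (l₂ : Fin L₂) (a : U) (b : V) :
    codebookMean Q₁ (fun u => codebookMean Q₂ (fun v => wrongMetric d m₁ m₂
      (Function.update u (m₁, l₁) a) (Function.update v (m₂, l₂) b))) ≤
      confusion M₁ M₂ L₁ L₂ Q₁ Q₂ d a b := by
  have e1 : 0 ≤ ∑ a', Q₁ a' * d a' b := Finset.sum_nonneg fun _ _ => mul_nonneg (hQ₁ _) (hd ..)
  have e2 : 0 ≤ ∑ b', Q₂ b' * d a b' := Finset.sum_nonneg fun _ _ => mul_nonneg (hQ₂ _) (hd ..)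
  have e3 : 0 ≤ ∑ a', Q₁ a' * ∑ b', Q₂ b' * d a' b' := Finset.sum_nonneg fun _ _ =>
    mul_nonneg (hQ₁ _) (Finset.sum_nonneg fun _ _ => mul_nonneg (hQ₂ _) (hd ..))
  have hterm : ∀ (k : Fin M₁ × Fin L₁) (k' : Fin M₂ × Fin L₂),
      codebookMean Q₁ (fun u => codebookMean Q₂ (fun v =>
        if (k.1, k'.1) ≠ (m₁, m₂) then
          d (Function.update u (m₁, l₁) a k) (Function.update v (m₂, l₂) b k') else 0)) ≤
      (if k = (m₁, l₁) then (if k'.1 ≠ m₂ then ∑ b', Q₂ b' * d a b' else 0) else 0) +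
      (if k' = (m₂, l₂) then (if k.1 ≠ m₁ then ∑ a', Q₁ a' * d a' b else 0) else 0) +
      (if (k.1, k'.1) ≠ (m₁, m₂) then ∑ a', Q₁ a' * ∑ b', Q₂ b' * d a' b' else 0) := by
    intro k k'
    by_cases hne : (k.1, k'.1) ≠ (m₁, m₂)
    · simp only [hne, if_true, ne_eq, not_false_eq_true]
      have i1 : ∀ x, codebookMean Q₂ (fun v => d x (Function.update v (m₂, l₂) b k')) =
          if k' = (m₂, l₂) then d x b else ∑ b', Q₂ b' * d x b' :=
        fun x => codebookMean_update_eval hQ₂' _ k' b (d x)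
      simp only [i1]
      rw [codebookMean_update_eval hQ₁' _ k a
        (fun x => if k' = (m₂, l₂) then d x b else ∑ b', Q₂ b' * d x b')]
      by_cases hk : k = (m₁, l₁) <;> by_cases hk' : k' = (m₂, l₂)
      · subst hk; subst hk'; simp at hne
      · subst hk
        have : k'.1 ≠ m₂ := by simpa using hne
        simp [hk', this, e3]
      · subst hk'
        have : k.1 ≠ m₁ := by simpa using hne
        simp [hk, this, e3]
      · simp [hk, hk']
    · have h0 : codebookMean (ι := Fin M₁ × Fin L₁) Q₁ (fun _ => 0) = 0 :=
        codebookMean_const hQ₁' 0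
      have h0' : codebookMean (ι := Fin M₂ × Fin L₂) Q₂ (fun _ => 0) = 0 :=
        codebookMean_const hQ₂' 0
      simp only [hne, if_false, h0, h0', add_zero]
      split_ifs <;> positivity
  unfold wrongMetric
  simp only [codebookMean_sum]
  refine (Finset.sum_le_sum fun k _ => Finset.sum_le_sum fun k' _ => hterm k k').trans_eq ?_
  simp only [Finset.sum_add_distrib, sum_ne_pair]
  rw [confusion, ← sum_ne_fst m₁, ← sum_ne_fst m₂]
  congr 1
  rw [add_comm]
  congr 1
  · simp
  · rw [Finset.sum_comm]; simp

end OneShot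


/-! ### Mean success of likelihood encoding and decoding -/

section OneShot

variable {U V : Type*} [Fintype U] [Fintype V]
variable {M₁ M₂ L₁ L₂ : ℕ} {Q₁ : U → ℝ} {Q₂ : V → ℝ}

/-- The tangent bound for the contribution of one codeword pair to the success probability. -/
theorem tangent_le_success {k₁ w₁ A₁ k₂ w₂ A₂ d N W B L₁ L₂ : ℝ}
    (hk₁ : 0 ≤ k₁) (hkw₁ : k₁ ≤ w₁) (hA₁ : w₁ ≤ A₁) (hk₂ : 0 ≤ k₂) (hkw₂ : k₂ ≤ w₂)
    (hA₂ : w₂ ≤ A₂) (hd : 0 ≤ d) (hN : d ≤ N) (hW : 0 ≤ W) (hB : 0 ≤ B) (hL₁ : 0 < L₁)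
    (hL₂ : 0 < L₂) :
    k₁ * k₂ * (1 / (w₁ + L₁)) * (1 / (w₂ + L₂)) * (d / (d + B)) *
      (4 - A₁ / (w₁ + L₁) - A₂ / (w₂ + L₂) - (d + W) / (d + B)) ≤
    k₁ / A₁ * (k₂ / A₂) * (N / (N + W)) := by
  have hr : 0 ≤ k₁ / A₁ * (k₂ / A₂) * (N / (N + W)) := by
    have : 0 ≤ A₁ := by linarith
    have : 0 ≤ A₂ := by linarith
    have : 0 ≤ N := by linarith
    positivity
  -- If a weight or the metric vanishes, so does the left side; otherwise every denominator is
  -- positive.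
  rcases hk₁.eq_or_lt with rfl | hk₁
  · simp
  rcases hk₂.eq_or_lt with rfl | hk₂
  · simp
  rcases hd.eq_or_lt with rfl | hd
  · simpa using hr
  have a1 : 0 < A₁ := by linarith
  have a2 : 0 < A₂ := by linarith
  have b1 : 0 < w₁ + L₁ := by linarith
  have b2 : 0 < w₂ + L₂ := by linarith
  have c1 : 0 < d + W := by linarith
  have c2 : 0 < d + B := by linarith
  -- Each denominator is measured in units of its conditional mean bound, so that the tangent is
  -- taken at `(1, 1, 1)`.
  calc _ ≤ k₁ * k₂ * (1 / (w₁ + L₁)) * (1 / (w₂ + L₂)) * (d / (d + B)) *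
        (1 / (A₁ / (w₁ + L₁) * (A₂ / (w₂ + L₂)) * ((d + W) / (d + B)))) :=
        mul_le_mul_of_nonneg_left
          (tangent_le_inv_mul (by positivity) (by positivity) (by positivity)) (by positivity)
    _ = k₁ / A₁ * (k₂ / A₂) * (d / (d + W)) := by field_simp
    _ ≤ _ := mul_le_mul_of_nonneg_left (div_add_div_add_le hd.le hW hN) (by positivity)

/-- The average contribution of a fixed codeword pair. -/
theorem le_codebookMean_tangent (hQ₁ : ∀ a, 0 ≤ Q₁ a) (hQ₁' : ∑ a, Q₁ a = 1)
    (hQ₂ : ∀ b, 0 ≤ Q₂ b) (hQ₂' : ∑ b, Q₂ b = 1) (hM₁ : 0 < M₁) (hM₂ : 0 < M₂)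
    {w₁ : U → ℝ} (hw₁ : ∀ a, 0 ≤ w₁ a) (hw₁' : ∑ a, Q₁ a * w₁ a ≤ 1)
    {w₂ : V → ℝ} (hw₂ : ∀ b, 0 ≤ w₂ b) (hw₂' : ∑ b, Q₂ b * w₂ b ≤ 1)
    {d : U → V → ℝ} (hd : ∀ a b, 0 ≤ d a b) {G : U → V → ℝ} (hG : ∀ a b, 0 ≤ G a b)
    (hGd : ∀ a b, d a b = 0 → G a b = 0)
    (m₁ : Fin M₁) (l₁ : Fin L₁) (m₂ : Fin M₂) (l₂ : Fin L₂) :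
    ∑ a, Q₁ a * ∑ b, Q₂ b * G a b ≤
      codebookMean Q₁ fun u => codebookMean Q₂ fun v => G (u (m₁, l₁)) (v (m₂, l₂)) *
        (4 - (∑ l, w₁ (u (m₁, l))) / (w₁ (u (m₁, l₁)) + L₁) -
          (∑ l, w₂ (v (m₂, l))) / (w₂ (v (m₂, l₂)) + L₂) -
          (d (u (m₁, l₁)) (v (m₂, l₂)) + wrongMetric d m₁ m₂ u v) /
            (d (u (m₁, l₁)) (v (m₂, l₂)) +
              confusion M₁ M₂ L₁ L₂ Q₁ Q₂ d (u (m₁, l₁)) (v (m₂, l₂)))) := by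
  have hL₁ : (0 : ℝ) < L₁ := by exact_mod_cast l₁.pos
  have hL₂ : (0 : ℝ) < L₂ := by exact_mod_cast l₂.pos
  rw [codebookMean_update hQ₁' (m₁, l₁)]
  refine Finset.sum_le_sum fun a _ => mul_le_mul_of_nonneg_left ?_ (hQ₁ a)
  have hv : ∀ H : (Fin M₁ × Fin L₁ → U) → (Fin M₂ × Fin L₂ → V) → ℝ,
      codebookMean Q₁ (fun u => codebookMean Q₂ (H u)) = ∑ b, Q₂ b *
        codebookMean Q₁ fun u => codebookMean Q₂ fun v => H u (Function.update v (m₂, l₂) b) := by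
    intro H
    rw [funext fun u => codebookMean_update hQ₂' (m₂, l₂) (H u), codebookMean_sum]
    simp only [codebookMean_mul_left]
  rw [hv]
  refine Finset.sum_le_sum fun b _ => mul_le_mul_of_nonneg_left ?_ (hQ₂ b)
  simp only [Function.update_self, codebookMean_mul_left]
  rcases (hd a b).eq_or_lt with h0 | hdab
  · simp [hGd a b h0.symm]
  have hB := confusion_nonneg (L₁ := L₁) (L₂ := L₂) hM₁ hM₂ hQ₁ hQ₂ hd a b
  -- Each of the three normalised denominators has conditional mean at most 1, so the bracket has
  -- mean at least `4 - 1 - 1 - 1 = 1`.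
  refine le_mul_of_one_le_right (hG a b) ?_
  simp only [codebookMean_sub, codebookMean_div, codebookMean_add, codebookMean_const hQ₁',
    codebookMean_const hQ₂']
  have j1 := codebookMean_likelihood_le hQ₁' hw₁' m₁ l₁ a
  have j2 := codebookMean_likelihood_le hQ₂' hw₂' m₂ l₂ b
  have j3 := codebookMean_wrongMetric_le hQ₁ hQ₁' hQ₂ hQ₂' hd m₁ l₁ m₂ l₂ a b
  have i1 := (div_le_one (by linarith [hw₁ a] : 0 < w₁ a + (L₁ : ℝ))).2 j1
  have i2 := (div_le_one (by linarith [hw₂ b] : 0 < w₂ b + (L₂ : ℝ))).2 j2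
  have i3 := (div_le_one (by linarith : 0 < d a b + confusion M₁ M₂ L₁ L₂ Q₁ Q₂ d a b)).2
    (add_le_add_right j3 (d a b))
  linarith

/-- The average success probability of likelihood encoding and likelihood decoding, for fixed
messages, states, inputs and output. Here `k₁`, `k₂` are the encoder weights that go to the given
inputs, out of the total weights `w₁`, `w₂`. -/
theorem le_codebookMean_success (hQ₁ : ∀ a, 0 ≤ Q₁ a) (hQ₁' : ∑ a, Q₁ a = 1)
    (hQ₂ : ∀ b, 0 ≤ Q₂ b) (hQ₂' : ∑ b, Q₂ b = 1) (hL₁ : 0 < L₁) (hL₂ : 0 < L₂)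
    {k₁ w₁ : U → ℝ} (hk₁ : ∀ a, 0 ≤ k₁ a) (hkw₁ : ∀ a, k₁ a ≤ w₁ a) (hw₁' : ∑ a, Q₁ a * w₁ a ≤ 1)
    {k₂ w₂ : V → ℝ} (hk₂ : ∀ b, 0 ≤ k₂ b) (hkw₂ : ∀ b, k₂ b ≤ w₂ b) (hw₂' : ∑ b, Q₂ b * w₂ b ≤ 1)
    {d : U → V → ℝ} (hd : ∀ a b, 0 ≤ d a b) (m₁ : Fin M₁) (m₂ : Fin M₂) :
    ∑ a, Q₁ a * ∑ b, Q₂ b * (k₁ a * k₂ b * (L₁ / (w₁ a + L₁)) * (L₂ / (w₂ b + L₂)) *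
        (d a b / (d a b + confusion M₁ M₂ L₁ L₂ Q₁ Q₂ d a b))) ≤
      codebookMean Q₁ fun u : Fin M₁ × Fin L₁ → U => codebookMean Q₂ fun v : Fin M₂ × Fin L₂ → V =>
        (∑ l, k₁ (u (m₁, l)) / ∑ l', w₁ (u (m₁, l'))) *
        (∑ l, k₂ (v (m₂, l)) / ∑ l', w₂ (v (m₂, l'))) *
        (messageMetric d m₁ m₂ u v / ∑ k, ∑ k', d (u k) (v k')) := by
  have hM₁ := m₁.pos
  have hM₂ := m₂.pos
  have hL₁' : (0 : ℝ) < L₁ := by exact_mod_cast hL₁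
  have hL₂' : (0 : ℝ) < L₂ := by exact_mod_cast hL₂
  have hw₁ : ∀ a, 0 ≤ w₁ a := fun a => (hk₁ a).trans (hkw₁ a)
  have hw₂ : ∀ a, 0 ≤ w₂ a := fun a => (hk₂ a).trans (hkw₂ a)
  have hB := confusion_nonneg (L₁ := L₁) (L₂ := L₂) hM₁ hM₂ hQ₁ hQ₂ hd
  set G : U → V → ℝ := fun a b => k₁ a * k₂ b * (1 / (w₁ a + L₁)) * (1 / (w₂ b + L₂)) *
    (d a b / (d a b + confusion M₁ M₂ L₁ L₂ Q₁ Q₂ d a b)) with hG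
  have hG0 : ∀ a b, 0 ≤ G a b := fun a b => by
    have := hk₁ a; have := hk₂ b; have := hw₁ a; have := hw₂ b; have := hd a b; have := hB a b
    simp only [hG]; positivity
  -- The `L₁ * L₂` codeword pairs of the right bins have equal bounds, which turns `1 / (w + L)`
  -- into `L / (w + L)`.
  calc _ = ∑ _l₁ : Fin L₁, ∑ _l₂ : Fin L₂, ∑ a, Q₁ a * ∑ b, Q₂ b * G a b := by
        simp only [Finset.sum_const, Finset.card_univ, Fintype.card_fin, nsmul_eq_mul,
          Finset.mul_sum, hG]
        refine Finset.sum_congr rfl fun a _ => Finset.sum_congr rfl fun b _ => ?_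
        ring
    _ ≤ _ := Finset.sum_le_sum fun l₁ _ => Finset.sum_le_sum fun l₂ _ =>
        le_codebookMean_tangent hQ₁ hQ₁' hQ₂ hQ₂' hM₁ hM₂ hw₁ hw₁' hw₂ hw₂' hd hG0
          (fun a b h => by simp [hG, h]) m₁ l₁ m₂ l₂
    _ ≤ _ := by
        simp only [← codebookMean_sum]
        refine codebookMean_mono hQ₁ fun u => codebookMean_mono hQ₂ fun v => ?_
        rw [Finset.sum_mul_sum, Finset.sum_mul]
        refine Finset.sum_le_sum fun l₁ _ => ?_
        rw [Finset.sum_mul]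
        refine Finset.sum_le_sum fun l₂ _ => ?_
        rw [sum_eq_messageMetric_add_wrongMetric d m₁ m₂]
        refine tangent_le_success (hk₁ _) (hkw₁ _) ?_ (hk₂ _) (hkw₂ _) ?_ (hd ..) ?_ ?_ (hB ..)
          hL₁' hL₂'
        · exact Finset.single_le_sum (f := fun l => w₁ (u (m₁, l))) (fun l _ => hw₁ _)
            (Finset.mem_univ l₁)
        · exact Finset.single_le_sum (f := fun l => w₂ (v (m₂, l))) (fun l _ => hw₂ _)
            (Finset.mem_univ l₂)
        · refine (Finset.single_le_sum (f := fun l => d (u (m₁, l₁)) (v (m₂, l)))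
            (fun l _ => hd _ _) (Finset.mem_univ l₂)).trans ?_
          exact Finset.single_le_sum (f := fun l => ∑ l', d (u (m₁, l)) (v (m₂, l')))
            (fun l _ => Finset.sum_nonneg fun _ _ => hd _ _) (Finset.mem_univ l₁)
        · refine Finset.sum_nonneg fun _ _ => Finset.sum_nonneg fun _ _ => ?_
          split_ifs
          · exact hd _ _
          · exact le_rfl

end OneShot


/-! ### From random codebooks to one deterministic code -/

section OneShot

variable {S₁ S₂ X₁ X₂ Y U V : Type*} [Fintype S₁] [Fintype S₂] [Fintype X₁] [Fintype X₂]
  [Fintype Y] [Fintype U] [Fintype V]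

/-- The sum of the joint law of states, inputs, output and auxiliary symbols against `f`. -/
def jointMean (p : S₁ → S₂ → ℝ) (K₁ : S₁ → U → X₁ → ℝ) (K₂ : S₂ → V → X₂ → ℝ)
    (T : X₁ → X₂ → S₁ → S₂ → Y → ℝ) (f : S₁ → X₁ → S₂ → X₂ → Y → U → V → ℝ) : ℝ :=
  ∑ s₁, ∑ x₁, ∑ s₂, ∑ x₂, ∑ y, ∑ a, ∑ b,
    p s₁ s₂ * T x₁ x₂ s₁ s₂ y * (K₁ s₁ a x₁ * K₂ s₂ b x₂) * f s₁ x₁ s₂ x₂ y a b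

theorem sum_messageMetric {U V : Type*} {M₁ M₂ L₁ L₂ : ℕ} (d : U → V → ℝ) (u : Fin M₁ × Fin L₁ → U)
    (v : Fin M₂ × Fin L₂ → V) :
    ∑ w : Fin M₁ × Fin M₂, messageMetric d w.1 w.2 u v = ∑ k, ∑ k', d (u k) (v k') := by
  simp only [messageMetric, Fintype.sum_prod_type]
  exact Finset.sum_congr rfl fun m _ => Finset.sum_comm

/-- Only an inequality: if all weights of the bin vanish, division by zero gives 0, and the missing
mass counts as failure. -/
theorem sum_sum_div_le_one {U : Type*} {M L : ℕ} (k : U → X₁ → ℝ) (u : Fin M × Fin L → U) (m : Fin M) :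
    ∑ x, ∑ l, k (u (m, l)) x / ∑ l', ∑ x', k (u (m, l')) x' ≤ 1 := by
  rw [Finset.sum_comm]
  simp only [← Finset.sum_div]
  exact div_self_le_one _

/-- One-shot achievability: some deterministic code succeeds at least as often as the mean bound
for random codebooks with codeword laws `Q₁`, `Q₂` and decoding metric `d`. -/
theorem exists_code_success_ge [Nonempty X₁] [Nonempty X₂] {M₁ M₂ L₁ L₂ : ℕ}
    (hM₁ : 0 < M₁) (hM₂ : 0 < M₂) (hL₁ : 0 < L₁) (hL₂ : 0 < L₂)
    {p : S₁ → S₂ → ℝ} (hp : ∀ s₁ s₂, 0 ≤ p s₁ s₂)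
    {K₁ : S₁ → U → X₁ → ℝ} (hK₁ : ∀ s a x, 0 ≤ K₁ s a x) (hK₁' : ∀ s, ∑ a, ∑ x, K₁ s a x = 1)
    {K₂ : S₂ → V → X₂ → ℝ} (hK₂ : ∀ s b x, 0 ≤ K₂ s b x) (hK₂' : ∀ s, ∑ b, ∑ x, K₂ s b x = 1)
    {T : X₁ → X₂ → S₁ → S₂ → Y → ℝ} (hT : ∀ x₁ x₂ s₁ s₂ y, 0 ≤ T x₁ x₂ s₁ s₂ y)
    {Q₁ : U → ℝ} (hQ₁ : ∀ a, 0 < Q₁ a) (hQ₁' : ∑ a, Q₁ a = 1)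
    {Q₂ : V → ℝ} (hQ₂ : ∀ b, 0 < Q₂ b) (hQ₂' : ∑ b, Q₂ b = 1)
    {d : Y → U → V → ℝ} (hd : ∀ y a b, 0 ≤ d y a b) :
    ∃ (enc₁ : Fin M₁ → S₁ → X₁) (enc₂ : Fin M₂ → S₂ → X₂) (dec : Y → Fin M₁ × Fin M₂),
      jointMean p K₁ K₂ T (fun s₁ _ s₂ _ y a b =>
        (L₁ / ((∑ x, K₁ s₁ a x) / Q₁ a + L₁)) * (L₂ / ((∑ x, K₂ s₂ b x) / Q₂ b + L₂)) *
          (d y a b / (d y a b + confusion M₁ M₂ L₁ L₂ Q₁ Q₂ (d y) a b))) ≤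
      ∑ m₁, ∑ m₂, ∑ s₁, ∑ s₂, ∑ y, 1 / (M₁ : ℝ) * (1 / (M₂ : ℝ)) * p s₁ s₂ *
        T (enc₁ m₁ s₁) (enc₂ m₂ s₂) s₁ s₂ y * (if dec y = (m₁, m₂) then 1 else 0) := by
  have : Nonempty (Fin M₁ × Fin M₂) := ⟨(⟨0, hM₁⟩, ⟨0, hM₂⟩)⟩
  -- The weight covers codeword and input at once; dividing by `Q₁` makes the mean over random
  -- codewords reproduce the kernel.
  set k₁ : S₁ → U → X₁ → ℝ := fun s a x => K₁ s a x / Q₁ a with hk₁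
  set k₂ : S₂ → V → X₂ → ℝ := fun s b x => K₂ s b x / Q₂ b with hk₂
  have hk₁0 : ∀ s a x, 0 ≤ k₁ s a x := fun s a x => div_nonneg (hK₁ ..) (hQ₁ a).le
  have hk₂0 : ∀ s a x, 0 ≤ k₂ s a x := fun s a x => div_nonneg (hK₂ ..) (hQ₂ a).le
  have hw₁ : ∀ s a, ∑ x, k₁ s a x = (∑ x, K₁ s a x) / Q₁ a := fun s a =>
    (Finset.sum_div ..).symm
  have hw₂ : ∀ s a, ∑ x, k₂ s a x = (∑ x, K₂ s a x) / Q₂ a := fun s a =>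
    (Finset.sum_div ..).symm
  have hs₁ : ∀ s, ∑ a, Q₁ a * ∑ x, k₁ s a x ≤ 1 := fun s => by
    simp only [hw₁, mul_div_cancel₀ _ (hQ₁ _).ne', hK₁', le_refl]
  have hs₂ : ∀ s, ∑ a, Q₂ a * ∑ x, k₂ s a x ≤ 1 := fun s => by
    simp only [hw₂, mul_div_cancel₀ _ (hQ₂ _).ne', hK₂', le_refl]
  let E₁ : (Fin M₁ × Fin L₁ → U) → Fin M₁ × S₁ → X₁ → ℝ := fun u a x =>
    ∑ l, k₁ a.2 (u (a.1, l)) x / ∑ l', ∑ x', k₁ a.2 (u (a.1, l')) x'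
  let E₂ : (Fin M₂ × Fin L₂ → V) → Fin M₂ × S₂ → X₂ → ℝ := fun v a x =>
    ∑ l, k₂ a.2 (v (a.1, l)) x / ∑ l', ∑ x', k₂ a.2 (v (a.1, l')) x'
  let D : (Fin M₁ × Fin L₁ → U) → (Fin M₂ × Fin L₂ → V) → Y → Fin M₁ × Fin M₂ → ℝ := fun u v y w =>
    messageMetric (d y) w.1 w.2 u v / ∑ k, ∑ k', d y (u k) (v k')
  let c : Fin M₁ × S₁ → X₁ → Fin M₂ × S₂ → X₂ → Y → Fin M₁ × Fin M₂ → ℝ := fun a x b z y w =>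
    p a.2 b.2 * T x z a.2 b.2 y * if w = (a.1, b.1) then 1 else 0
  let F : (Fin M₁ × Fin L₁ → U) → (Fin M₂ × Fin L₂ → V) → ℝ := fun u v =>
    ∑ a, ∑ x, E₁ u a x * ∑ b, ∑ z, E₂ v b z * ∑ y, ∑ w, D u v y w * c a x b z y w
  let Φ : S₁ → X₁ → S₂ → X₂ → Y → ℝ := fun s₁ x₁ s₂ x₂ y => ∑ a, ∑ b,
    p s₁ s₂ * T x₁ x₂ s₁ s₂ y * (K₁ s₁ a x₁ * K₂ s₂ b x₂) *
      ((L₁ / ((∑ x, K₁ s₁ a x) / Q₁ a + L₁)) * (L₂ / ((∑ x, K₂ s₂ b x) / Q₂ b + L₂)) *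
          (d y a b / (d y a b + confusion M₁ M₂ L₁ L₂ Q₁ Q₂ (d y) a b)))
  have hF : ∀ u v, F u v = ∑ a, ∑ x, ∑ b, ∑ z, ∑ y,
      p a.2 b.2 * T x z a.2 b.2 y * (E₁ u a x * E₂ v b z * D u v y (a.1, b.1)) := by
    intro u v
    simp only [F, c, Finset.mul_sum]
    refine Finset.sum_congr rfl fun a _ => Finset.sum_congr rfl fun x _ =>
      Finset.sum_congr rfl fun b _ => Finset.sum_congr rfl fun z _ =>
      Finset.sum_congr rfl fun y _ => ?_
    rw [Finset.sum_eq_single (a.1, b.1) (fun w _ hw => by simp [hw]) (by simp)]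
    simp only [if_true]
    ring
  have hmean : (M₁ : ℝ) * M₂ * ∑ s₁, ∑ x₁, ∑ s₂, ∑ x₂, ∑ y, Φ s₁ x₁ s₂ x₂ y ≤
      codebookMean Q₁ fun u => codebookMean Q₂ fun v => F u v := by
    simp only [hF, codebookMean_sum, codebookMean_mul_left]
    calc _ = ∑ a : Fin M₁ × S₁, ∑ x, ∑ b : Fin M₂ × S₂, ∑ z, ∑ y, Φ a.2 x b.2 z y := by
          simp only [Fintype.sum_prod_type, Finset.sum_const, Finset.card_univ, Fintype.card_fin,
            nsmul_eq_mul, Finset.mul_sum]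
          simp only [mul_assoc]
      _ ≤ _ := by
          refine Finset.sum_le_sum fun a _ => Finset.sum_le_sum fun x _ =>
            Finset.sum_le_sum fun b _ => Finset.sum_le_sum fun z _ =>
            Finset.sum_le_sum fun y _ => ?_
          have key := le_codebookMean_success (fun a => (hQ₁ a).le) hQ₁' (fun b => (hQ₂ b).le) hQ₂'
            hL₁ hL₂ (k₁ := fun u => k₁ a.2 u x) (w₁ := fun u => ∑ x, k₁ a.2 u x)
            (fun u => hk₁0 ..) (fun u => Finset.single_le_sum (fun x _ => hk₁0 a.2 u x)
              (Finset.mem_univ x)) (hs₁ a.2)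
            (k₂ := fun v => k₂ b.2 v z) (w₂ := fun v => ∑ x, k₂ b.2 v x)
            (fun u => hk₂0 ..) (fun u => Finset.single_le_sum (fun x _ => hk₂0 b.2 u x)
              (Finset.mem_univ z)) (hs₂ b.2) (hd y) a.1 b.1
          refine le_trans (Eq.le ?_) (mul_le_mul_of_nonneg_left key
            (mul_nonneg (hp a.2 b.2) (hT x z a.2 b.2 y)))
          simp only [Φ, Finset.mul_sum, hw₁, hw₂]
          refine Finset.sum_congr rfl fun a' _ => Finset.sum_congr rfl fun b' _ => ?_
          have e1 : K₁ a.2 a' x = Q₁ a' * k₁ a.2 a' x := (mul_div_cancel₀ _ (hQ₁ _).ne').symm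
          have e2 : K₂ b.2 b' z = Q₂ b' * k₂ b.2 b' z := (mul_div_cancel₀ _ (hQ₂ _).ne').symm
          rw [e1, e2]
          ring
  obtain ⟨u, hu⟩ := exists_codebookMean_le (fun a => (hQ₁ a).le) hQ₁'
    (fun u => codebookMean Q₂ fun v => F u v)
  obtain ⟨v, hv⟩ := exists_codebookMean_le (fun a => (hQ₂ a).le) hQ₂' (fun v => F u v)
  have hQpos : ∀ y, 0 ≤ ∑ k, ∑ k', d y (u k) (v k') := fun y =>
    Finset.sum_nonneg fun _ _ => Finset.sum_nonneg fun _ _ => hd ..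
  obtain ⟨f, g, h, hfgh⟩ := exists_deterministic (E₁ u) (E₂ v) (D u v) c
    (fun a x => Finset.sum_nonneg fun _ _ => div_nonneg (hk₁0 ..) <|
      Finset.sum_nonneg fun _ _ => Finset.sum_nonneg fun _ _ => hk₁0 ..)
    (fun a => sum_sum_div_le_one (k₁ a.2) u a.1)
    (fun a x => Finset.sum_nonneg fun _ _ => div_nonneg (hk₂0 ..) <|
      Finset.sum_nonneg fun _ _ => Finset.sum_nonneg fun _ _ => hk₂0 ..)
    (fun a => sum_sum_div_le_one (k₂ a.2) v a.1)
    (fun y w => div_nonneg (Finset.sum_nonneg fun _ _ => Finset.sum_nonneg fun _ _ => hd ..)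
      (hQpos y))
    (fun y => by
      simp only [D, ← Finset.sum_div, sum_messageMetric]
      exact div_self_le_one _)
    (fun a x b z y w => mul_nonneg (mul_nonneg (hp ..) (hT ..)) (by split_ifs <;> norm_num))
  refine ⟨fun m s => f (m, s), fun m s => g (m, s), h, ?_⟩
  have hfin := hmean.trans (hu.trans (hv.trans hfgh))
  have hM₁' : (0 : ℝ) < M₁ := by exact_mod_cast hM₁
  have hM₂' : (0 : ℝ) < M₂ := by exact_mod_cast hM₂
  have hJ : ∑ s₁, ∑ x₁, ∑ s₂, ∑ x₂, ∑ y, Φ s₁ x₁ s₂ x₂ y ≤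
      1 / (M₁ : ℝ) * (1 / (M₂ : ℝ)) * ∑ a, ∑ b, ∑ y, c a (f a) b (g b) y (h y) := by
    rw [div_mul_div_comm, one_mul, div_mul_eq_mul_div, one_mul, le_div_iff₀ (by positivity)]
    linarith
  refine hJ.trans (Eq.le ?_)
  simp only [c, Fintype.sum_prod_type, Finset.mul_sum]
  refine Finset.sum_congr rfl fun m₁ _ => ?_
  rw [Finset.sum_comm]
  refine Finset.sum_congr rfl fun m₂ _ => Finset.sum_congr rfl fun s₁ _ =>
    Finset.sum_congr rfl fun s₂ _ => Finset.sum_congr rfl fun y _ => ?_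
  ring

end OneShot


/-! ### The one-shot bound in moment form -/

section OneShot

variable {S₁ S₂ X₁ X₂ Y U V : Type*} [Fintype S₁] [Fintype S₂] [Fintype X₁] [Fintype X₂]
  [Fintype Y] [Fintype U] [Fintype V]

/-- The quotient is at most `min 1 (a / b)`, and `min 1 z ≤ z ^ t` for `t` in the unit interval. -/
theorem div_add_le_rpow {a b t : ℝ} (ha : 0 ≤ a) (hb : 0 < b) (ht : 0 ≤ t) (ht1 : t ≤ 1) :
    a / (b + a) ≤ (a / b) ^ t := by
  rcases le_total a b with h | h
  · calc a / (b + a) ≤ a / b := div_le_div_of_nonneg_left ha hb (by linarith)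
      _ = (a / b) ^ (1 : ℝ) := (Real.rpow_one _).symm
      _ ≤ (a / b) ^ t :=
        Real.rpow_le_rpow_of_exponent_ge' (by positivity) ((div_le_one hb).2 h) ht ht1
  · calc a / (b + a) ≤ 1 := (div_le_one (by linarith)).2 (by linarith)
      _ ≤ (a / b) ^ t := Real.one_le_rpow ((one_le_div hb).2 h) ht

theorem one_sub_mul_mul_le {x y z : ℝ} (hx1 : x ≤ 1) (hy : 0 ≤ y) (hy1 : y ≤ 1)
    (hz1 : z ≤ 1) : 1 - x * y * z ≤ (1 - x) + (1 - y) + (1 - z) := by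
  nlinarith [mul_nonneg (sub_nonneg.2 hx1) (sub_nonneg.2 hy1),
    mul_le_one₀ hx1 hy hy1, mul_nonneg (sub_nonneg.2 (mul_le_one₀ hx1 hy hy1)) (sub_nonneg.2 hz1)]

/-- A union bound over the three factors, with the decoding failure split further among the classes
of competitors. Each of the five terms keeps its own exponent, since each is later tuned separately.
-/
theorem one_sub_success_le {w₁ w₂ L₁ L₂ d b₁ b₂ b₃ t₁ t₂ t₃ t₄ t₅ : ℝ} (hw₁ : 0 ≤ w₁)
    (hw₂ : 0 ≤ w₂) (hL₁ : 0 < L₁) (hL₂ : 0 < L₂) (hd : 0 < d) (hb₁ : 0 ≤ b₁) (hb₂ : 0 ≤ b₂)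
    (hb₃ : 0 ≤ b₃) (ht₁ : t₁ ∈ Set.Icc 0 1) (ht₂ : t₂ ∈ Set.Icc 0 1) (ht₃ : t₃ ∈ Set.Icc 0 1)
    (ht₄ : t₄ ∈ Set.Icc 0 1) (ht₅ : t₅ ∈ Set.Icc 0 1) :
    1 - L₁ / (w₁ + L₁) * (L₂ / (w₂ + L₂)) * (d / (d + (b₁ + b₂ + b₃))) ≤
      (w₁ / L₁) ^ t₁ + (w₂ / L₂) ^ t₂ + (b₁ / d) ^ t₃ + (b₂ / d) ^ t₄ + (b₃ / d) ^ t₅ := by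
  have e : ∀ {w L : ℝ}, 0 ≤ w → 0 < L → 1 - L / (w + L) = w / (L + w) := fun hw hL => by
    field_simp; ring
  have l1 : ∀ {w L : ℝ}, 0 ≤ w → 0 < L → L / (w + L) ≤ 1 := fun hw hL =>
    (div_le_one (by linarith)).2 (by linarith)
  have ed : 1 - d / (d + (b₁ + b₂ + b₃)) ≤ b₁ / (d + b₁) + b₂ / (d + b₂) + b₃ / (d + b₃) := by
    have : 1 - d / (d + (b₁ + b₂ + b₃)) = b₁ / (d + (b₁ + b₂ + b₃)) +
        b₂ / (d + (b₁ + b₂ + b₃)) + b₃ / (d + (b₁ + b₂ + b₃)) := by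
      field_simp; ring
    rw [this]
    gcongr <;> linarith
  have h := one_sub_mul_mul_le (l1 hw₁ hL₁)
    (by positivity : 0 ≤ L₂ / (w₂ + L₂)) (l1 hw₂ hL₂)
    ((div_le_one (by positivity)).2 (by linarith) : d / (d + (b₁ + b₂ + b₃)) ≤ 1)
  rw [e hw₁ hL₁, e hw₂ hL₂] at h
  linarith [div_add_le_rpow hw₁ hL₁ ht₁.1 ht₁.2, div_add_le_rpow hw₂ hL₂ ht₂.1 ht₂.2,
    div_add_le_rpow hb₁ hd ht₃.1 ht₃.2, div_add_le_rpow hb₂ hd ht₄.1 ht₄.2,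
    div_add_le_rpow hb₃ hd ht₅.1 ht₅.2]

theorem jointMean_one {p : S₁ → S₂ → ℝ} (hp : ∑ s₁, ∑ s₂, p s₁ s₂ = 1)
    {K₁ : S₁ → U → X₁ → ℝ} (hK₁ : ∀ s, ∑ a, ∑ x, K₁ s a x = 1)
    {K₂ : S₂ → V → X₂ → ℝ} (hK₂ : ∀ s, ∑ b, ∑ x, K₂ s b x = 1)
    {T : X₁ → X₂ → S₁ → S₂ → Y → ℝ} (hT : ∀ x₁ x₂ s₁ s₂, ∑ y, T x₁ x₂ s₁ s₂ y = 1) :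
    jointMean p K₁ K₂ T (fun _ _ _ _ _ _ _ => 1) = 1 := by
  have h1 : ∀ s₁ x₁ s₂ x₂, ∑ y, ∑ a, ∑ b,
      p s₁ s₂ * T x₁ x₂ s₁ s₂ y * (K₁ s₁ a x₁ * K₂ s₂ b x₂) =
      p s₁ s₂ * ((∑ a, K₁ s₁ a x₁) * ∑ b, K₂ s₂ b x₂) := by
    intro s₁ x₁ s₂ x₂
    simp only [← Finset.mul_sum, ← Finset.sum_mul]
    rw [hT, mul_one]
  have h2 : ∀ s, ∑ x, ∑ b, K₂ s b x = 1 := fun s => by rw [Finset.sum_comm, hK₂]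
  have h3 : ∀ s, ∑ x, ∑ a, K₁ s a x = 1 := fun s => by rw [Finset.sum_comm, hK₁]
  simp only [jointMean, mul_one, h1]
  simp only [← Finset.mul_sum, h2, mul_one]
  calc _ = ∑ s₁, ∑ s₂, p s₁ s₂ * ∑ x, ∑ a, K₁ s₁ a x := by
        refine Finset.sum_congr rfl fun s₁ _ => ?_
        rw [Finset.sum_comm]
        simp only [Finset.mul_sum]
    _ = 1 := by simp only [h3, mul_one, hp]

theorem jointMean_add (p : S₁ → S₂ → ℝ) (K₁ : S₁ → U → X₁ → ℝ) (K₂ : S₂ → V → X₂ → ℝ)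
    (T : X₁ → X₂ → S₁ → S₂ → Y → ℝ) (f g : S₁ → X₁ → S₂ → X₂ → Y → U → V → ℝ) :
    jointMean p K₁ K₂ T (fun s₁ x₁ s₂ x₂ y a b => f s₁ x₁ s₂ x₂ y a b + g s₁ x₁ s₂ x₂ y a b) =
      jointMean p K₁ K₂ T f + jointMean p K₁ K₂ T g := by
  simp only [jointMean, mul_add, Finset.sum_add_distrib]

/-- One-shot achievability, in terms of moments of the likelihood ratios. -/
theorem exists_code_error_le [Nonempty X₁] [Nonempty X₂] {M₁ M₂ L₁ L₂ : ℕ}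
    (hM₁ : 0 < M₁) (hM₂ : 0 < M₂) (hL₁ : 0 < L₁) (hL₂ : 0 < L₂)
    {p : S₁ → S₂ → ℝ} (hp : ∀ s₁ s₂, 0 ≤ p s₁ s₂) (hp' : ∑ s₁, ∑ s₂, p s₁ s₂ = 1)
    {K₁ : S₁ → U → X₁ → ℝ} (hK₁ : ∀ s a x, 0 ≤ K₁ s a x) (hK₁' : ∀ s, ∑ a, ∑ x, K₁ s a x = 1)
    {K₂ : S₂ → V → X₂ → ℝ} (hK₂ : ∀ s b x, 0 ≤ K₂ s b x) (hK₂' : ∀ s, ∑ b, ∑ x, K₂ s b x = 1)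
    {T : X₁ → X₂ → S₁ → S₂ → Y → ℝ} (hT : ∀ x₁ x₂ s₁ s₂ y, 0 ≤ T x₁ x₂ s₁ s₂ y)
    (hT' : ∀ x₁ x₂ s₁ s₂, ∑ y, T x₁ x₂ s₁ s₂ y = 1)
    {Q₁ : U → ℝ} (hQ₁ : ∀ a, 0 < Q₁ a) (hQ₁' : ∑ a, Q₁ a = 1)
    {Q₂ : V → ℝ} (hQ₂ : ∀ b, 0 < Q₂ b) (hQ₂' : ∑ b, Q₂ b = 1)
    {d : Y → U → V → ℝ} (hd : ∀ y a b, 0 ≤ d y a b)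
    (hd' : ∀ s₁ x₁ s₂ x₂ y a b, p s₁ s₂ * T x₁ x₂ s₁ s₂ y * (K₁ s₁ a x₁ * K₂ s₂ b x₂) ≠ 0 →
      d y a b ≠ 0) {t₁ t₂ t₃ t₄ t₅ : ℝ}
    (ht₁ : t₁ ∈ Set.Icc 0 1) (ht₂ : t₂ ∈ Set.Icc 0 1) (ht₃ : t₃ ∈ Set.Icc 0 1)
    (ht₄ : t₄ ∈ Set.Icc 0 1) (ht₅ : t₅ ∈ Set.Icc 0 1) :
    ∃ (enc₁ : Fin M₁ → S₁ → X₁) (enc₂ : Fin M₂ → S₂ → X₂) (dec : Y → Fin M₁ × Fin M₂),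
      ∑ m₁, ∑ m₂, ∑ s₁, ∑ s₂, ∑ y, 1 / (M₁ : ℝ) * (1 / (M₂ : ℝ)) * p s₁ s₂ *
        T (enc₁ m₁ s₁) (enc₂ m₂ s₂) s₁ s₂ y * (if dec y = (m₁, m₂) then 0 else 1) ≤
      jointMean p K₁ K₂ T (fun s₁ _ _ _ _ a _ => (((∑ x, K₁ s₁ a x) / Q₁ a) / L₁) ^ t₁) +
      jointMean p K₁ K₂ T (fun _ _ s₂ _ _ _ b => (((∑ x, K₂ s₂ b x) / Q₂ b) / L₂) ^ t₂) +
      jointMean p K₁ K₂ T (fun _ _ _ _ y a b =>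
        (((M₁ : ℝ) - 1) * L₁ * (∑ a', Q₁ a' * d y a' b) / d y a b) ^ t₃) +
      jointMean p K₁ K₂ T (fun _ _ _ _ y a b =>
        (((M₂ : ℝ) - 1) * L₂ * (∑ b', Q₂ b' * d y a b') / d y a b) ^ t₄) +
      jointMean p K₁ K₂ T (fun _ _ _ _ y a b =>
        (((M₁ : ℝ) * M₂ - 1) * L₁ * L₂ * (∑ a', Q₁ a' * ∑ b', Q₂ b' * d y a' b') / d y a b) ^ t₅)
      := by
  obtain ⟨f, g, h, hs⟩ := exists_code_success_ge hM₁ hM₂ hL₁ hL₂ hp hK₁ hK₁' hK₂ hK₂' hT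
    hQ₁ hQ₁' hQ₂ hQ₂' hd
  refine ⟨f, g, h, ?_⟩
  have hM₁' : (1 : ℝ) ≤ M₁ := by exact_mod_cast hM₁
  have hM₂' : (1 : ℝ) ≤ M₂ := by exact_mod_cast hM₂
  have hL₁' : (0 : ℝ) < L₁ := by exact_mod_cast hL₁
  have hL₂' : (0 : ℝ) < L₂ := by exact_mod_cast hL₂
  have htot : ∑ m₁, ∑ m₂, ∑ s₁, ∑ s₂, ∑ y, 1 / (M₁ : ℝ) * (1 / (M₂ : ℝ)) * p s₁ s₂ *
      T (f m₁ s₁) (g m₂ s₂) s₁ s₂ y = 1 := by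
    simp only [← Finset.mul_sum, hT', mul_one, hp']
    simp only [Finset.sum_const, Finset.card_univ, Fintype.card_fin, nsmul_eq_mul]
    field_simp
  have hsum : (∑ m₁, ∑ m₂, ∑ s₁, ∑ s₂, ∑ y, 1 / (M₁ : ℝ) * (1 / (M₂ : ℝ)) * p s₁ s₂ *
        T (f m₁ s₁) (g m₂ s₂) s₁ s₂ y * (if h y = (m₁, m₂) then 0 else 1)) =
      1 - ∑ m₁, ∑ m₂, ∑ s₁, ∑ s₂, ∑ y, 1 / (M₁ : ℝ) * (1 / (M₂ : ℝ)) * p s₁ s₂ *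
        T (f m₁ s₁) (g m₂ s₂) s₁ s₂ y * (if h y = (m₁, m₂) then 1 else 0) := by
    refine eq_sub_of_add_eq (Eq.trans ?_ htot)
    simp only [← Finset.sum_add_distrib]
    refine Finset.sum_congr rfl fun _ _ => Finset.sum_congr rfl fun _ _ =>
      Finset.sum_congr rfl fun _ _ => Finset.sum_congr rfl fun _ _ =>
      Finset.sum_congr rfl fun _ _ => ?_
    split_ifs <;> ring
  rw [hsum]
  refine (sub_le_sub_left hs 1).trans ?_
  refine (congrArg (· - _) (jointMean_one hp' hK₁' hK₂' hT').symm).trans_le ?_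
  simp only [← jointMean_add]
  simp only [jointMean, ← Finset.sum_sub_distrib, ← mul_sub]
  refine Finset.sum_le_sum fun s₁ _ => Finset.sum_le_sum fun x₁ _ => Finset.sum_le_sum fun s₂ _ =>
    Finset.sum_le_sum fun x₂ _ => Finset.sum_le_sum fun y _ => Finset.sum_le_sum fun a _ =>
    Finset.sum_le_sum fun b _ => ?_
  have hP : 0 ≤ p s₁ s₂ * T x₁ x₂ s₁ s₂ y * (K₁ s₁ a x₁ * K₂ s₂ b x₂) :=
    mul_nonneg (mul_nonneg (hp ..) (hT ..)) (mul_nonneg (hK₁ ..) (hK₂ ..))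
  -- Off the support of the joint law the metric may vanish, but there the whole term is zero.
  rcases hP.eq_or_lt with h0 | hpos
  · simp only [← h0, zero_mul, le_refl]
  have hdp : 0 < d y a b := (hd ..).lt_of_ne' (hd' s₁ x₁ s₂ x₂ y a b hpos.ne')
  refine mul_le_mul_of_nonneg_left ?_ hP
  have e1 : 0 ≤ ∑ a', Q₁ a' * d y a' b :=
    Finset.sum_nonneg fun _ _ => mul_nonneg (hQ₁ _).le (hd ..)
  have e2 : 0 ≤ ∑ b', Q₂ b' * d y a b' :=
    Finset.sum_nonneg fun _ _ => mul_nonneg (hQ₂ _).le (hd ..)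
  have e3 : 0 ≤ ∑ a', Q₁ a' * ∑ b', Q₂ b' * d y a' b' := Finset.sum_nonneg fun _ _ =>
    mul_nonneg (hQ₁ _).le (Finset.sum_nonneg fun _ _ => mul_nonneg (hQ₂ _).le (hd ..))
  have f1 : (0 : ℝ) ≤ (M₁ : ℝ) - 1 := by linarith
  have f2 : (0 : ℝ) ≤ (M₂ : ℝ) - 1 := by linarith
  have f3 : (0 : ℝ) ≤ (M₁ : ℝ) * M₂ - 1 := by nlinarith
  exact one_sub_success_le
    (div_nonneg (Finset.sum_nonneg fun _ _ => hK₁ ..) (hQ₁ a).le)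
    (div_nonneg (Finset.sum_nonneg fun _ _ => hK₂ ..) (hQ₂ b).le) hL₁' hL₂' hdp
    (by positivity) (by positivity) (by positivity) ht₁ ht₂ ht₃ ht₄ ht₅

end OneShot


/-! ### Block codes with time sharing -/

section Block

variable {S₁ S₂ X₁ X₂ Y : Type*} [Fintype S₁] [Fintype S₂] [Fintype X₁] [Fintype X₂] [Fintype Y]

theorem jointMean_mul_left {U V : Type*} [Fintype U] [Fintype V] (p : S₁ → S₂ → ℝ)
    (K₁ : S₁ → U → X₁ → ℝ) (K₂ : S₂ → V → X₂ → ℝ) (T : X₁ → X₂ → S₁ → S₂ → Y → ℝ) (c : ℝ)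
    (f : S₁ → X₁ → S₂ → X₂ → Y → U → V → ℝ) :
    jointMean p K₁ K₂ T (fun s₁ x₁ s₂ x₂ y a b => c * f s₁ x₁ s₂ x₂ y a b) =
      c * jointMean p K₁ K₂ T f := by
  simp only [jointMean, mul_left_comm _ c, ← Finset.mul_sum]

variable {ι : Type*} [Fintype ι] [DecidableEq ι]

/-- Sums of products over seven families factor. -/
theorem sum_pi_prod_seven {A B C D E F G : ι → Type*} [∀ i, Fintype (A i)] [∀ i, Fintype (B i)]
    [∀ i, Fintype (C i)] [∀ i, Fintype (D i)] [∀ i, Fintype (E i)] [∀ i, Fintype (F i)]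
    [∀ i, Fintype (G i)] (g : ∀ i, A i → B i → C i → D i → E i → F i → G i → ℝ) :
    ∑ a : ∀ i, A i, ∑ b : ∀ i, B i, ∑ c : ∀ i, C i, ∑ d : ∀ i, D i, ∑ e : ∀ i, E i,
      ∑ f : ∀ i, F i, ∑ h : ∀ i, G i, ∏ i, g i (a i) (b i) (c i) (d i) (e i) (f i) (h i) =
    ∏ i, ∑ a, ∑ b, ∑ c, ∑ d, ∑ e, ∑ f, ∑ h, g i a b c d e f h := by
  refine (Finset.sum_congr rfl fun a _ => ?_).trans
    (sum_pi_prod fun i a => ∑ b, ∑ c, ∑ d, ∑ e, ∑ f, ∑ h, g i a b c d e f h)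
  refine (Finset.sum_congr rfl fun b _ => ?_).trans
    (sum_pi_prod fun i b => ∑ c, ∑ d, ∑ e, ∑ f, ∑ h, g i (a i) b c d e f h)
  refine (Finset.sum_congr rfl fun c _ => ?_).trans
    (sum_pi_prod fun i c => ∑ d, ∑ e, ∑ f, ∑ h, g i (a i) (b i) c d e f h)
  refine (Finset.sum_congr rfl fun d _ => ?_).trans
    (sum_pi_prod fun i d => ∑ e, ∑ f, ∑ h, g i (a i) (b i) (c i) d e f h)
  refine (Finset.sum_congr rfl fun e _ => ?_).trans
    (sum_pi_prod fun i e => ∑ f, ∑ h, g i (a i) (b i) (c i) (d i) e f h)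
  refine (Finset.sum_congr rfl fun f _ => ?_).trans
    (sum_pi_prod fun i f => ∑ h, g i (a i) (b i) (c i) (d i) (e i) f h)
  exact sum_pi_prod fun i h => g i (a i) (b i) (c i) (d i) (e i) (f i) h

variable {U V : ι → Type*} [∀ i, Fintype (U i)] [∀ i, Fintype (V i)]
  (p : S₁ → S₂ → ℝ) (K₁ : ∀ i, S₁ → U i → X₁ → ℝ) (K₂ : ∀ i, S₂ → V i → X₂ → ℝ)
  (T : X₁ → X₂ → S₁ → S₂ → Y → ℝ)

/-- The auxiliary alphabets depend on the coordinate because a schedule may use a different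
admissible pair at each time. -/
theorem jointMean_prod (f : ∀ i, S₁ → X₁ → S₂ → X₂ → Y → U i → V i → ℝ) :
    jointMean (S₁ := ι → S₁) (S₂ := ι → S₂) (X₁ := ι → X₁) (X₂ := ι → X₂) (Y := ι → Y)
      (U := ∀ i, U i) (V := ∀ i, V i) (fun s₁ s₂ => ∏ i, p (s₁ i) (s₂ i))
      (fun s a x => ∏ i, K₁ i (s i) (a i) (x i)) (fun s b x => ∏ i, K₂ i (s i) (b i) (x i))
      (fun x₁ x₂ s₁ s₂ y => ∏ i, T (x₁ i) (x₂ i) (s₁ i) (s₂ i) (y i))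
      (fun s₁ x₁ s₂ x₂ y a b => ∏ i, f i (s₁ i) (x₁ i) (s₂ i) (x₂ i) (y i) (a i) (b i)) =
    ∏ i, jointMean p (K₁ i) (K₂ i) T (f i) := by
  simp only [jointMean, ← Finset.prod_mul_distrib]
  exact sum_pi_prod_seven (A := fun _ => S₁) (B := fun _ => X₁) (C := fun _ => S₂)
    (D := fun _ => X₂) (E := fun _ => Y) (F := U) (G := V) fun i s₁ x₁ s₂ x₂ y a b =>
      p s₁ s₂ * T x₁ x₂ s₁ s₂ y * (K₁ i s₁ a x₁ * K₂ i s₂ b x₂) * f i s₁ x₁ s₂ x₂ y a b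

theorem jointMean_mul_prod_rpow {c : ℝ} (hc : 0 ≤ c) (t : ℝ)
    (r : ∀ i, S₁ → X₁ → S₂ → X₂ → Y → U i → V i → ℝ) (hr : ∀ i s₁ x₁ s₂ x₂ y a b,
      0 ≤ r i s₁ x₁ s₂ x₂ y a b)
    (F : (ι → S₁) → (ι → X₁) → (ι → S₂) → (ι → X₂) → (ι → Y) → (∀ i, U i) → (∀ i, V i) → ℝ)
    (hF : ∀ s₁ x₁ s₂ x₂ y a b, F s₁ x₁ s₂ x₂ y a b =
      c * ∏ i, r i (s₁ i) (x₁ i) (s₂ i) (x₂ i) (y i) (a i) (b i)) :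
    jointMean (fun s₁ s₂ => ∏ i, p (s₁ i) (s₂ i))
      (fun s a x => ∏ i, K₁ i (s i) (a i) (x i)) (fun s b x => ∏ i, K₂ i (s i) (b i) (x i))
      (fun x₁ x₂ s₁ s₂ y => ∏ i, T (x₁ i) (x₂ i) (s₁ i) (s₂ i) (y i))
      (fun s₁ x₁ s₂ x₂ y a b => F s₁ x₁ s₂ x₂ y a b ^ t) =
    c ^ t * ∏ i, jointMean p (K₁ i) (K₂ i) T
      (fun s₁ x₁ s₂ x₂ y a b => r i s₁ x₁ s₂ x₂ y a b ^ t) := by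
  rw [← jointMean_prod, ← jointMean_mul_left]
  congr 1
  funext s₁ x₁ s₂ x₂ y a b
  rw [hF, Real.mul_rpow hc (Finset.prod_nonneg fun i _ => hr ..),
    Real.finsetProd_rpow _ _ fun i _ => hr ..]

end Block

namespace StateMAC

section Block

variable {S₁ S₂ X₁ X₂ Y : Type*} [Fintype S₁] [Fintype S₂] [Fintype X₁] [Fintype X₂] [Fintype Y]

/-- The sum of the joint law of an admissible pair against `f`. -/
def pairMean (W : StateMAC S₁ S₂ X₁ X₂ Y) {U V : Type*} [Fintype U] [Fintype V]
    (a : AdmissiblePair S₁ S₂ X₁ X₂ U V) (f : S₁ → X₁ → S₂ → X₂ → Y → U → V → ℝ) : ℝ :=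
  jointMean (fun s₁ s₂ => W.state (s₁, s₂)) (fun s u x => a.kernel₁ s (u, x))
    (fun s v x => a.kernel₂ s (v, x)) W.trans f

/-- The one-shot bound applied to sequence alphabets. Codeword laws and metric are products too, so
the sums over competitors factor along with the joint law. -/
theorem exists_code_errorProb_le_of_schedule (W : StateMAC S₁ S₂ X₁ X₂ Y) [Nonempty X₁]
    [Nonempty X₂] {n M₁ M₂ L₁ L₂ : ℕ}
    (hM₁ : 0 < M₁) (hM₂ : 0 < M₂) (hL₁ : 0 < L₁) (hL₂ : 0 < L₂)
    {U V : Fin n → Type*} [∀ i, Fintype (U i)] [∀ i, Fintype (V i)]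
    (a : ∀ i, AdmissiblePair S₁ S₂ X₁ X₂ (U i) (V i))
    {Q₁ : ∀ i, U i → ℝ} (hQ₁ : ∀ i u, 0 < Q₁ i u) (hQ₁' : ∀ i, ∑ u, Q₁ i u = 1)
    {Q₂ : ∀ i, V i → ℝ} (hQ₂ : ∀ i v, 0 < Q₂ i v) (hQ₂' : ∀ i, ∑ v, Q₂ i v = 1)
    {d : ∀ i, Y → U i → V i → ℝ} (hd : ∀ i y u v, 0 ≤ d i y u v)
    (hd' : ∀ i s₁ x₁ s₂ x₂ y u v, W.state (s₁, s₂) * W.trans x₁ x₂ s₁ s₂ y *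
      ((a i).kernel₁ s₁ (u, x₁) * (a i).kernel₂ s₂ (v, x₂)) ≠ 0 → d i y u v ≠ 0)
    {t₁ t₂ t₃ t₄ t₅ : ℝ}
    (ht₁ : t₁ ∈ Set.Icc 0 1) (ht₂ : t₂ ∈ Set.Icc 0 1) (ht₃ : t₃ ∈ Set.Icc 0 1)
    (ht₄ : t₄ ∈ Set.Icc 0 1) (ht₅ : t₅ ∈ Set.Icc 0 1) :
    ∃ c : MACCode S₁ S₂ X₁ X₂ Y n M₁ M₂, W.errorProb c ≤
      (1 / (L₁ : ℝ)) ^ t₁ * ∏ i, W.pairMean (a i) (fun s₁ _ _ _ _ u _ =>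
        ((∑ x, (a i).kernel₁ s₁ (u, x)) / Q₁ i u) ^ t₁) +
      (1 / (L₂ : ℝ)) ^ t₂ * ∏ i, W.pairMean (a i) (fun _ _ s₂ _ _ _ v =>
        ((∑ x, (a i).kernel₂ s₂ (v, x)) / Q₂ i v) ^ t₂) +
      (((M₁ : ℝ) - 1) * L₁) ^ t₃ * ∏ i, W.pairMean (a i) (fun _ _ _ _ y u v =>
        ((∑ u', Q₁ i u' * d i y u' v) / d i y u v) ^ t₃) +
      (((M₂ : ℝ) - 1) * L₂) ^ t₄ * ∏ i, W.pairMean (a i) (fun _ _ _ _ y u v =>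
        ((∑ v', Q₂ i v' * d i y u v') / d i y u v) ^ t₄) +
      (((M₁ : ℝ) * M₂ - 1) * L₁ * L₂) ^ t₅ * ∏ i, W.pairMean (a i) (fun _ _ _ _ y u v =>
        ((∑ u', Q₁ i u' * ∑ v', Q₂ i v' * d i y u' v') / d i y u v) ^ t₅) := by
  have hM₁' : (1 : ℝ) ≤ M₁ := by exact_mod_cast hM₁
  have hM₂' : (1 : ℝ) ≤ M₂ := by exact_mod_cast hM₂
  have f1 : (0 : ℝ) ≤ (M₁ : ℝ) - 1 := by linarith
  have f2 : (0 : ℝ) ≤ (M₂ : ℝ) - 1 := by linarith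
  have f3 : (0 : ℝ) ≤ (M₁ : ℝ) * M₂ - 1 := by nlinarith
  have hk₁ : ∀ i s u x, 0 ≤ (a i).kernel₁ s (u, x) := fun i s u x => ((a i).kernel₁_mem s).1 _
  have hk₂ : ∀ i s v x, 0 ≤ (a i).kernel₂ s (v, x) := fun i s v x => ((a i).kernel₂_mem s).1 _
  have hk₁' : ∀ i s, ∑ u, ∑ x, (a i).kernel₁ s (u, x) = 1 := fun i s => by
    rw [← Fintype.sum_prod_type']; exact ((a i).kernel₁_mem s).2
  have hk₂' : ∀ i s, ∑ u, ∑ x, (a i).kernel₂ s (u, x) = 1 := fun i s => by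
    rw [← Fintype.sum_prod_type']; exact ((a i).kernel₂_mem s).2
  obtain ⟨f, g, h, hfgh⟩ := exists_code_error_le (S₁ := Fin n → S₁) (S₂ := Fin n → S₂)
    (X₁ := Fin n → X₁) (X₂ := Fin n → X₂) (Y := Fin n → Y) (U := ∀ i, U i) (V := ∀ i, V i)
    hM₁ hM₂ hL₁ hL₂
    (p := fun s₁ s₂ => ∏ i, W.state (s₁ i, s₂ i))
    (fun s₁ s₂ => Finset.prod_nonneg fun i _ => W.state_mem.1 _)
    (by
      refine (Finset.sum_congr rfl fun s₁ _ => sum_pi_prod fun i s => W.state (s₁ i, s)).trans ?_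
      rw [sum_pi_prod fun i s => ∑ s', W.state (s, s')]
      refine Finset.prod_eq_one fun i _ => ?_
      rw [← Fintype.sum_prod_type']
      exact W.state_mem.2)
    (K₁ := fun s u x => ∏ i, (a i).kernel₁ (s i) (u i, x i))
    (fun s u x => Finset.prod_nonneg fun i _ => hk₁ ..)
    (fun s => by
      refine (Finset.sum_congr rfl fun u _ =>
        sum_pi_prod fun i x => (a i).kernel₁ (s i) (u i, x)).trans ?_
      rw [sum_pi_prod fun i u => ∑ x, (a i).kernel₁ (s i) (u, x)]
      exact Finset.prod_eq_one fun i _ => hk₁' ..)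
    (K₂ := fun s u x => ∏ i, (a i).kernel₂ (s i) (u i, x i))
    (fun s u x => Finset.prod_nonneg fun i _ => hk₂ ..)
    (fun s => by
      refine (Finset.sum_congr rfl fun u _ =>
        sum_pi_prod fun i x => (a i).kernel₂ (s i) (u i, x)).trans ?_
      rw [sum_pi_prod fun i u => ∑ x, (a i).kernel₂ (s i) (u, x)]
      exact Finset.prod_eq_one fun i _ => hk₂' ..)
    (T := fun x₁ x₂ s₁ s₂ y => ∏ i, W.trans (x₁ i) (x₂ i) (s₁ i) (s₂ i) (y i))
    (fun x₁ x₂ s₁ s₂ y => Finset.prod_nonneg fun i _ => (W.trans_mem ..).1 _)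
    (fun x₁ x₂ s₁ s₂ => by
      rw [sum_pi_prod fun i y => W.trans (x₁ i) (x₂ i) (s₁ i) (s₂ i) y]
      exact Finset.prod_eq_one fun i _ => (W.trans_mem ..).2)
    (Q₁ := fun u => ∏ i, Q₁ i (u i)) (fun u => Finset.prod_pos fun i _ => hQ₁ ..)
    (by rw [sum_pi_prod Q₁]; exact Finset.prod_eq_one fun i _ => hQ₁' i)
    (Q₂ := fun u => ∏ i, Q₂ i (u i)) (fun u => Finset.prod_pos fun i _ => hQ₂ ..)
    (by rw [sum_pi_prod Q₂]; exact Finset.prod_eq_one fun i _ => hQ₂' i)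
    (d := fun y u v => ∏ i, d i (y i) (u i) (v i))
    (fun y u v => Finset.prod_nonneg fun i _ => hd ..)
    (fun s₁ x₁ s₂ x₂ y u v hne => by
      simp only [← Finset.prod_mul_distrib] at hne
      exact Finset.prod_ne_zero_iff.2 fun i hi => hd' _ _ _ _ _ _ _ _
        (Finset.prod_ne_zero_iff.1 hne i hi)) ht₁ ht₂ ht₃ ht₄ ht₅
  have e₁ : ∀ (y : Fin n → Y) (v : ∀ i, V i),
      ∑ u : (∀ i, U i), (∏ i, Q₁ i (u i)) * ∏ i, d i (y i) (u i) (v i) =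
        ∏ i, ∑ u, Q₁ i u * d i (y i) u (v i) := fun y v => by
    simp only [← Finset.prod_mul_distrib]
    exact sum_pi_prod fun i u => Q₁ i u * d i (y i) u (v i)
  have e₂ : ∀ (y : Fin n → Y) (u : ∀ i, U i),
      ∑ v : (∀ i, V i), (∏ i, Q₂ i (v i)) * ∏ i, d i (y i) (u i) (v i) =
        ∏ i, ∑ v, Q₂ i v * d i (y i) (u i) v := fun y u => by
    simp only [← Finset.prod_mul_distrib]
    exact sum_pi_prod fun i v => Q₂ i v * d i (y i) (u i) v
  have e₃ : ∀ (y : Fin n → Y),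
      ∑ u : (∀ i, U i), (∏ i, Q₁ i (u i)) * ∏ i, ∑ v, Q₂ i v * d i (y i) (u i) v =
        ∏ i, ∑ u, Q₁ i u * ∑ v, Q₂ i v * d i (y i) u v := fun y => by
    simp only [← Finset.prod_mul_distrib]
    exact sum_pi_prod fun i u => Q₁ i u * ∑ v, Q₂ i v * d i (y i) u v
  refine ⟨⟨f, g, h⟩, hfgh.trans (Eq.le ?_)⟩
  have q₁ := fun i u => (hQ₁ i u).le
  have q₂ := fun i u => (hQ₂ i u).le
  have block := @jointMean_mul_prod_rpow _ _ _ _ _ _ _ _ _ _ (Fin n) _ _ U V _ _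
    (fun s₁ s₂ => W.state (s₁, s₂)) (fun i s u x => (a i).kernel₁ s (u, x))
    (fun i s v x => (a i).kernel₂ s (v, x)) W.trans
  unfold pairMean
  refine congrArg₂ HAdd.hAdd (congrArg₂ HAdd.hAdd (congrArg₂ HAdd.hAdd
    (congrArg₂ HAdd.hAdd ?_ ?_) ?_) ?_) ?_
  · refine block (by positivity) t₁
      (fun i s₁ _ _ _ _ u _ => (∑ x, (a i).kernel₁ s₁ (u, x)) / Q₁ i u)
      (fun i s₁ _ _ _ _ u _ => div_nonneg (Finset.sum_nonneg fun _ _ => hk₁ ..) (q₁ ..)) _ ?_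
    intro s₁ _ _ _ _ u _
    rw [sum_pi_prod fun i x => (a i).kernel₁ (s₁ i) (u i, x), Finset.prod_div_distrib]
    ring
  · refine block (by positivity) t₂
      (fun i _ _ s₂ _ _ _ v => (∑ x, (a i).kernel₂ s₂ (v, x)) / Q₂ i v)
      (fun i _ _ s₁ _ _ _ u => div_nonneg (Finset.sum_nonneg fun _ _ => hk₂ ..) (q₂ ..)) _ ?_
    intro _ _ s₂ _ _ _ v
    rw [sum_pi_prod fun i x => (a i).kernel₂ (s₂ i) (v i, x), Finset.prod_div_distrib]
    ring
  · refine block (by positivity) t₃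
      (fun i _ _ _ _ y u v => (∑ u', Q₁ i u' * d i y u' v) / d i y u v)
      (fun i _ _ _ _ y u v => div_nonneg
        (Finset.sum_nonneg fun _ _ => mul_nonneg (q₁ ..) (hd ..)) (hd ..)) _ ?_
    intro _ _ _ _ y u v
    rw [e₁, Finset.prod_div_distrib]
    ring
  · refine block (by positivity) t₄
      (fun i _ _ _ _ y u v => (∑ v', Q₂ i v' * d i y u v') / d i y u v)
      (fun i _ _ _ _ y u v => div_nonneg
        (Finset.sum_nonneg fun _ _ => mul_nonneg (q₂ ..) (hd ..)) (hd ..)) _ ?_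
    intro _ _ _ _ y u v
    rw [e₂, Finset.prod_div_distrib]
    ring
  · refine block (by positivity) t₅
      (fun i _ _ _ _ y u v => (∑ u', Q₁ i u' * ∑ v', Q₂ i v' * d i y u' v') / d i y u v)
      (fun i _ _ _ _ y u v => div_nonneg
        (Finset.sum_nonneg fun _ _ => mul_nonneg (q₁ ..)
          (Finset.sum_nonneg fun _ _ => mul_nonneg (q₂ ..) (hd ..))) (hd ..)) _ ?_
    intro _ _ _ _ y u v
    simp only [e₂, e₃, Finset.prod_div_distrib]
    ring

/-- Averaging over random schedules of admissible pairs: the error probability is bounded by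
powers of single-letter moments. -/
theorem exists_code_errorProb_le (W : StateMAC S₁ S₂ X₁ X₂ Y) [Nonempty X₁]
    [Nonempty X₂] {n M₁ M₂ L₁ L₂ : ℕ}
    (hM₁ : 0 < M₁) (hM₂ : 0 < M₂) (hL₁ : 0 < L₁) (hL₂ : 0 < L₂)
    {J : Type*} [Fintype J] {lam : J → ℝ} (hlam : ∀ j, 0 ≤ lam j) (hlam' : ∑ j, lam j = 1)
    {U V : J → Type*} [∀ j, Fintype (U j)] [∀ j, Fintype (V j)]
    (a : ∀ j, AdmissiblePair S₁ S₂ X₁ X₂ (U j) (V j))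
    {Q₁ : ∀ j, U j → ℝ} (hQ₁ : ∀ j u, 0 < Q₁ j u) (hQ₁' : ∀ j, ∑ u, Q₁ j u = 1)
    {Q₂ : ∀ j, V j → ℝ} (hQ₂ : ∀ j v, 0 < Q₂ j v) (hQ₂' : ∀ j, ∑ v, Q₂ j v = 1)
    {d : ∀ j, Y → U j → V j → ℝ} (hd : ∀ j y u v, 0 ≤ d j y u v)
    (hd' : ∀ j s₁ x₁ s₂ x₂ y u v, W.state (s₁, s₂) * W.trans x₁ x₂ s₁ s₂ y *
      ((a j).kernel₁ s₁ (u, x₁) * (a j).kernel₂ s₂ (v, x₂)) ≠ 0 → d j y u v ≠ 0)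
    {t₁ t₂ t₃ t₄ t₅ : ℝ}
    (ht₁ : t₁ ∈ Set.Icc 0 1) (ht₂ : t₂ ∈ Set.Icc 0 1) (ht₃ : t₃ ∈ Set.Icc 0 1)
    (ht₄ : t₄ ∈ Set.Icc 0 1) (ht₅ : t₅ ∈ Set.Icc 0 1) :
    ∃ c : MACCode S₁ S₂ X₁ X₂ Y n M₁ M₂, W.errorProb c ≤
      (1 / (L₁ : ℝ)) ^ t₁ * (∑ j, lam j * W.pairMean (a j) (fun s₁ _ _ _ _ u _ =>
        ((∑ x, (a j).kernel₁ s₁ (u, x)) / Q₁ j u) ^ t₁)) ^ n +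
      (1 / (L₂ : ℝ)) ^ t₂ * (∑ j, lam j * W.pairMean (a j) (fun _ _ s₂ _ _ _ v =>
        ((∑ x, (a j).kernel₂ s₂ (v, x)) / Q₂ j v) ^ t₂)) ^ n +
      (((M₁ : ℝ) - 1) * L₁) ^ t₃ * (∑ j, lam j * W.pairMean (a j) (fun _ _ _ _ y u v =>
        ((∑ u', Q₁ j u' * d j y u' v) / d j y u v) ^ t₃)) ^ n +
      (((M₂ : ℝ) - 1) * L₂) ^ t₄ * (∑ j, lam j * W.pairMean (a j) (fun _ _ _ _ y u v =>
        ((∑ v', Q₂ j v' * d j y u v') / d j y u v) ^ t₄)) ^ n +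
      (((M₁ : ℝ) * M₂ - 1) * L₁ * L₂) ^ t₅ *
        (∑ j, lam j * W.pairMean (a j) (fun _ _ _ _ y u v =>
          ((∑ u', Q₁ j u' * ∑ v', Q₂ j v' * d j y u' v') / d j y u v) ^ t₅)) ^ n := by
  have hcode := fun q : Fin n → J => W.exists_code_errorProb_le_of_schedule hM₁ hM₂ hL₁ hL₂
    (fun i => a (q i)) (fun i => hQ₁ (q i)) (fun i => hQ₁' (q i)) (fun i => hQ₂ (q i))
    (fun i => hQ₂' (q i)) (fun i => hd (q i)) (fun i => hd' (q i)) ht₁ ht₂ ht₃ ht₄ ht₅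
  choose c hc using hcode
  -- A random schedule is a random codebook indexed by time with letters in `J`. The sign is flipped
  -- because the lemma finds a value above the mean.
  obtain ⟨q, hq⟩ := exists_codebookMean_le hlam hlam' (fun q => - W.errorProb (c q))
  refine ⟨c q, ?_⟩
  have hneg : codebookMean lam (fun q => - W.errorProb (c q)) =
      - codebookMean lam (fun q => W.errorProb (c q)) := by
    simpa using codebookMean_mul_left (Q := lam) (-1) (fun q => W.errorProb (c q))
  rw [hneg, neg_le_neg_iff] at hq
  refine hq.trans ((codebookMean_mono hlam hc).trans (Eq.le ?_))
  have hprod : ∀ g : J → ℝ, codebookMean lam (fun q : Fin n → J => ∏ i, g (q i)) =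
      (∑ j, lam j * g j) ^ n := fun g => by
    simp only [codebookMean, ← Finset.prod_mul_distrib]
    rw [sum_pi_prod fun (_ : Fin n) j => lam j * g j]
    simp
  simp only [codebookMean_add, codebookMean_mul_left]
  refine congrArg₂ HAdd.hAdd (congrArg₂ HAdd.hAdd (congrArg₂ HAdd.hAdd
    (congrArg₂ HAdd.hAdd ?_ ?_) ?_) ?_) ?_ <;> refine congrArg _ ?_
  · exact hprod fun j => W.pairMean (a j) (fun s₁ _ _ _ _ u _ =>
      ((∑ x, (a j).kernel₁ s₁ (u, x)) / Q₁ j u) ^ t₁)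
  · exact hprod fun j => W.pairMean (a j) (fun _ _ s₂ _ _ _ v =>
      ((∑ x, (a j).kernel₂ s₂ (v, x)) / Q₂ j v) ^ t₂)
  · exact hprod fun j => W.pairMean (a j) (fun _ _ _ _ y u v =>
      ((∑ u', Q₁ j u' * d j y u' v) / d j y u v) ^ t₃)
  · exact hprod fun j => W.pairMean (a j) (fun _ _ _ _ y u v =>
      ((∑ v', Q₂ j v' * d j y u v') / d j y u v) ^ t₄)
  · exact hprod fun j => W.pairMean (a j) (fun _ _ _ _ y u v =>
      ((∑ u', Q₁ j u' * ∑ v', Q₂ j v' * d j y u' v') / d j y u v) ^ t₅)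

end Block

end StateMAC


/-! ### Single-letter information quantities as expectations -/

section InfoDensity

variable {Ω α β γ : Type*} [Fintype Ω]

theorem law_pos {p : Ω → ℝ} (hp : ∀ ω, 0 ≤ p ω) (f : Ω → α) {ω : Ω} (hω : p ω ≠ 0) :
    0 < law p f (f ω) := by
  classical
  refine Finset.sum_pos' (fun ω' _ => ?_) ⟨ω, Finset.mem_univ _, ?_⟩
  · split_ifs
    exacts [hp ω', le_rfl]
  · simpa using (hp ω).lt_of_ne' hω

theorem law_nonneg {p : Ω → ℝ} (hp : ∀ ω, 0 ≤ p ω) (f : Ω → α) (a : α) : 0 ≤ law p f a :=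
  Finset.sum_nonneg fun ω _ => by
    split_ifs
    exacts [hp ω, le_rfl]

theorem law_congr (p : Ω → ℝ) {f : Ω → α} {g : Ω → β} {a : α} {b : β}
    (h : ∀ ω, f ω = a ↔ g ω = b) : law p f a = law p g b := by
  classical
  unfold law
  exact Finset.sum_congr rfl fun ω _ => if_congr (h ω) rfl rfl

/-- Marginalisation, phrased so that the summed component may sit anywhere in the tuple. -/
theorem sum_law_eq_law [Fintype β] (p : Ω → ℝ) {f : Ω → α} {g : Ω → γ} {e : β → α} {c : γ}
    (k : Ω → β) (h : ∀ ω b, f ω = e b ↔ k ω = b ∧ g ω = c) :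
    ∑ b, law p f (e b) = law p g c := by
  classical
  unfold law
  rw [Finset.sum_comm]
  refine Finset.sum_congr rfl fun ω _ => ?_
  simp only [h, ite_and, Finset.sum_ite_eq, Finset.mem_univ, if_true]

theorem sum_law_mul [Fintype α] (p : Ω → ℝ) (f : Ω → α) (F : α → ℝ) :
    ∑ a, law p f a * F a = ∑ ω, p ω * F (f ω) := by
  classical
  simp only [law, Finset.sum_mul]
  rw [Finset.sum_comm]
  refine Finset.sum_congr rfl fun ω _ => ?_
  simp only [ite_mul, zero_mul, Finset.sum_ite_eq, Finset.mem_univ, if_true]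

variable [Fintype α] [Fintype β] [Fintype γ]

theorem mutualInfo_eq_sum (p : Ω → ℝ) (f : Ω → α) (g : Ω → β) :
    mutualInfo p f g = ∑ ω, p ω * Real.logb 2 (law p (fun ω => (f ω, g ω)) (f ω, g ω) /
      (law p f (f ω) * law p g (g ω))) := by
  rw [← sum_law_mul p (fun ω => (f ω, g ω)) fun x =>
    Real.logb 2 (law p (fun ω => (f ω, g ω)) x / (law p f x.1 * law p g x.2)),
    Fintype.sum_prod_type]
  rfl

theorem condMutualInfo_eq_sum (p : Ω → ℝ) (f : Ω → α) (g : Ω → β) (h : Ω → γ) :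
    condMutualInfo p f g h = ∑ ω, p ω * Real.logb 2
      (law p (fun ω => (f ω, g ω, h ω)) (f ω, g ω, h ω) * law p h (h ω) /
      (law p (fun ω => (f ω, h ω)) (f ω, h ω) * law p (fun ω => (g ω, h ω)) (g ω, h ω))) := by
  rw [← sum_law_mul p (fun ω => (f ω, g ω, h ω)) fun x =>
    Real.logb 2 (law p (fun ω => (f ω, g ω, h ω)) x * law p h x.2.2 /
      (law p (fun ω => (f ω, h ω)) (x.1, x.2.2) * law p (fun ω => (g ω, h ω)) x.2)),
    Fintype.sum_prod_type]
  simp only [Fintype.sum_prod_type]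
  rfl

/-- `I(f; g | h) - I(f; s | h)` when `f` has the conditional law `k` given `(s, h)`. -/
theorem condMutualInfo_sub {δ : Type*} [Fintype δ] {p : Ω → ℝ} (hp : ∀ ω, 0 ≤ p ω) (f : Ω → α)
    (g : Ω → β) (s : Ω → δ) (h : Ω → γ) (k : Ω → ℝ)
    (hk : ∀ ω, law p (fun ω => (f ω, s ω, h ω)) (f ω, s ω, h ω) =
      k ω * law p (fun ω => (s ω, h ω)) (s ω, h ω)) :
    condMutualInfo p f g h - condMutualInfo p f s h =
      - ∑ ω, p ω * Real.logb 2 (law p (fun ω => (g ω, h ω)) (g ω, h ω) * k ω /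
        law p (fun ω => (f ω, g ω, h ω)) (f ω, g ω, h ω)) := by
  rw [condMutualInfo_eq_sum, condMutualInfo_eq_sum, ← Finset.sum_sub_distrib,
    ← Finset.sum_neg_distrib]
  refine Finset.sum_congr rfl fun ω _ => ?_
  by_cases hω : p ω = 0
  · simp [hω]
  have l1 := law_pos hp (fun ω => (f ω, g ω, h ω)) hω
  have l2 := law_pos hp h hω
  have l3 := law_pos hp (fun ω => (f ω, h ω)) hω
  have l4 := law_pos hp (fun ω => (g ω, h ω)) hω
  have l5 := law_pos hp (fun ω => (f ω, s ω, h ω)) hω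
  have l6 := law_pos hp (fun ω => (s ω, h ω)) hω
  have hkω := hk ω
  rw [hkω] at l5 ⊢
  have l7 : 0 < k ω := pos_of_mul_pos_left l5 l6.le
  -- On the support all laws are positive, and those of `h`, `(f, h)` and `(s, h)` cancel in the
  -- difference of logarithms.
  rw [← mul_sub, ← mul_neg, ← Real.logb_inv,
    ← Real.logb_div (by positivity) (by positivity)]
  congr 2
  field_simp

/-- `I(f; g) - I(f; s)` when `f` has the conditional law `k` given `s`. -/
theorem mutualInfo_sub {p : Ω → ℝ} (hp : ∀ ω, 0 ≤ p ω) (f : Ω → α)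
    (g : Ω → β) (s : Ω → γ) (k : Ω → ℝ)
    (hk : ∀ ω, law p (fun ω => (f ω, s ω)) (f ω, s ω) = k ω * law p s (s ω)) :
    mutualInfo p f g - mutualInfo p f s =
      - ∑ ω, p ω * Real.logb 2 (law p g (g ω) * k ω / law p (fun ω => (f ω, g ω)) (f ω, g ω)) := by
  rw [mutualInfo_eq_sum, mutualInfo_eq_sum, ← Finset.sum_sub_distrib, ← Finset.sum_neg_distrib]
  refine Finset.sum_congr rfl fun ω _ => ?_
  by_cases hω : p ω = 0
  · simp [hω]
  have l1 := law_pos hp (fun ω => (f ω, g ω)) hω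
  have l2 := law_pos hp f hω
  have l3 := law_pos hp g hω
  have l5 := law_pos hp (fun ω => (f ω, s ω)) hω
  have l6 := law_pos hp s hω
  have hkω := hk ω
  rw [hkω] at l5 ⊢
  have l7 : 0 < k ω := pos_of_mul_pos_left l5 l6.le
  rw [← mul_sub, ← mul_neg, ← Real.logb_inv,
    ← Real.logb_div (by positivity) (by positivity)]
  congr 2
  field_simp

end InfoDensity

/-! ### Conditional laws of the auxiliary symbols -/

namespace StateMAC

section SingleLetter

variable {S₁ S₂ X₁ X₂ Y U V : Type*} [Fintype S₁] [Fintype S₂] [Fintype X₁] [Fintype X₂]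
  [Fintype Y] [Fintype U] [Fintype V]

theorem jointLaw_nonneg (W : StateMAC S₁ S₂ X₁ X₂ Y) (a : AdmissiblePair S₁ S₂ X₁ X₂ U V)
    (ω : U × V × X₁ × X₂ × S₁ × S₂ × Y) : 0 ≤ W.jointLaw a ω :=
  mul_nonneg (mul_nonneg (mul_nonneg (W.state_mem.1 _) ((a.kernel₁_mem _).1 _))
    ((a.kernel₂_mem _).1 _)) ((W.trans_mem ..).1 _)

theorem pairMean_eq_sum (W : StateMAC S₁ S₂ X₁ X₂ Y) (a : AdmissiblePair S₁ S₂ X₁ X₂ U V)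
    (f : S₁ → X₁ → S₂ → X₂ → Y → U → V → ℝ) :
    W.pairMean a f = ∑ ω : U × V × X₁ × X₂ × S₁ × S₂ × Y, W.jointLaw a ω *
      f ω.2.2.2.2.1 ω.2.2.1 ω.2.2.2.2.2.1 ω.2.2.2.1 ω.2.2.2.2.2.2 ω.1 ω.2.1 := by
  let e : S₁ × X₁ × S₂ × X₂ × Y × U × V ≃ U × V × X₁ × X₂ × S₁ × S₂ × Y :=
    { toFun := fun ω => (ω.2.2.2.2.2.1, ω.2.2.2.2.2.2, ω.2.1, ω.2.2.2.1, ω.1, ω.2.2.1, ω.2.2.2.2.1)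
      invFun := fun ω => (ω.2.2.2.2.1, ω.2.2.1, ω.2.2.2.2.2.1, ω.2.2.2.1, ω.2.2.2.2.2.2, ω.1, ω.2.1)
      left_inv := fun _ => rfl
      right_inv := fun _ => rfl }
  rw [← e.sum_comp]
  simp only [Fintype.sum_prod_type, pairMean, jointMean]
  refine Finset.sum_congr rfl fun _ _ => Finset.sum_congr rfl fun _ _ =>
    Finset.sum_congr rfl fun _ _ => Finset.sum_congr rfl fun _ _ =>
    Finset.sum_congr rfl fun _ _ => Finset.sum_congr rfl fun _ _ =>
    Finset.sum_congr rfl fun _ _ => ?_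
  simp only [e, Equiv.coe_fn_mk, jointLaw]
  ring

/-- The conditional law `P(u | s₁)`. -/
def AdmissiblePair.aux₁ (a : AdmissiblePair S₁ S₂ X₁ X₂ U V) (s : S₁) (u : U) : ℝ :=
  ∑ x, a.kernel₁ s (u, x)

/-- The conditional law `P(v | s₂)`. -/
def AdmissiblePair.aux₂ (a : AdmissiblePair S₁ S₂ X₁ X₂ U V) (s : S₂) (v : V) : ℝ :=
  ∑ x, a.kernel₂ s (v, x)

theorem pairMean_eq_of_states (W : StateMAC S₁ S₂ X₁ X₂ Y)
    (a : AdmissiblePair S₁ S₂ X₁ X₂ U V) (f : S₁ → S₂ → U → V → ℝ) :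
    W.pairMean a (fun s₁ _ s₂ _ _ u v => f s₁ s₂ u v) = ∑ s₁, ∑ s₂, W.state (s₁, s₂) *
      ∑ u, ∑ v, a.aux₁ s₁ u * a.aux₂ s₂ v * f s₁ s₂ u v := by
  unfold pairMean jointMean
  refine Finset.sum_congr rfl fun s₁ _ => ?_
  rw [Finset.sum_comm]
  refine Finset.sum_congr rfl fun s₂ _ => ?_
  calc _ = ∑ x₁, ∑ x₂, ∑ u, ∑ v, (∑ y, W.trans x₁ x₂ s₁ s₂ y) * (W.state (s₁, s₂) *
        (a.kernel₁ s₁ (u, x₁) * a.kernel₂ s₂ (v, x₂) * f s₁ s₂ u v)) := by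
        refine Finset.sum_congr rfl fun x₁ _ => Finset.sum_congr rfl fun x₂ _ => ?_
        rw [Finset.sum_comm]
        refine Finset.sum_congr rfl fun u _ => ?_
        rw [Finset.sum_comm]
        refine Finset.sum_congr rfl fun v _ => ?_
        rw [Finset.sum_mul]
        exact Finset.sum_congr rfl fun y _ => by ring
    _ = ∑ u, ∑ v, ∑ x₁, ∑ x₂, W.state (s₁, s₂) *
        (a.kernel₁ s₁ (u, x₁) * a.kernel₂ s₂ (v, x₂) * f s₁ s₂ u v) := by
        simp only [(W.trans_mem _ _ _ _).2, one_mul]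
        rw [Finset.sum_congr rfl fun x₁ _ => Finset.sum_comm, Finset.sum_comm]
        refine Finset.sum_congr rfl fun u _ => ?_
        rw [Finset.sum_congr rfl fun x₁ _ => Finset.sum_comm, Finset.sum_comm]
    _ = _ := by
        rw [Finset.mul_sum]
        refine Finset.sum_congr rfl fun u _ => ?_
        rw [Finset.mul_sum]
        refine Finset.sum_congr rfl fun v _ => ?_
        rw [AdmissiblePair.aux₁, AdmissiblePair.aux₂, Finset.sum_mul_sum, Finset.sum_mul,
          Finset.mul_sum]
        refine Finset.sum_congr rfl fun x₁ _ => ?_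
        rw [Finset.sum_mul, Finset.mul_sum]

theorem law_jointLaw_of_states {α : Type*} [DecidableEq α] (W : StateMAC S₁ S₂ X₁ X₂ Y)
    (a : AdmissiblePair S₁ S₂ X₁ X₂ U V) (g : S₁ → S₂ → U → V → α) (c : α) :
    law (W.jointLaw a) (fun ω => g ω.2.2.2.2.1 ω.2.2.2.2.2.1 ω.1 ω.2.1) c =
      ∑ s₁, ∑ s₂, W.state (s₁, s₂) *
        ∑ u, ∑ v, a.aux₁ s₁ u * a.aux₂ s₂ v * if g s₁ s₂ u v = c then 1 else 0 := by
  rw [← pairMean_eq_of_states, pairMean_eq_sum, law]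
  exact Finset.sum_congr rfl fun ω _ => by split_ifs <;> simp

theorem AdmissiblePair.sum_aux₁ {S₁ S₂ : Type*} (a : AdmissiblePair S₁ S₂ X₁ X₂ U V) (s : S₁) :
    ∑ u, a.aux₁ s u = 1 := by
  unfold AdmissiblePair.aux₁
  rw [← Fintype.sum_prod_type']; exact (a.kernel₁_mem s).2

theorem AdmissiblePair.sum_aux₂ {S₁ S₂ : Type*} (a : AdmissiblePair S₁ S₂ X₁ X₂ U V) (s : S₂) :
    ∑ u, a.aux₂ s u = 1 := by
  unfold AdmissiblePair.aux₂
  rw [← Fintype.sum_prod_type']; exact (a.kernel₂_mem s).2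

/-- Given `S₁`, the symbol `U` is drawn independently of `S₂` and hence of `V`; this is the Markov
property behind the form of the rate bounds. -/
theorem law_aux₁ (W : StateMAC S₁ S₂ X₁ X₂ Y) (a : AdmissiblePair S₁ S₂ X₁ X₂ U V)
    (u : U) (s : S₁) (v : V) :
    law (W.jointLaw a) (fun ω => (ω.1, ω.2.2.2.2.1, ω.2.1)) (u, s, v) =
      a.aux₁ s u * law (W.jointLaw a) (fun ω => (ω.2.2.2.2.1, ω.2.1)) (s, v) := by
  classical
  rw [W.law_jointLaw_of_states a (fun s₁ s₂ u v => (u, s₁, v)),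
    W.law_jointLaw_of_states a (fun s₁ s₂ u v => (s₁, v))]
  simp only [Prod.mk.injEq, ite_and, mul_ite, mul_one, mul_zero, Finset.sum_ite_eq',
    Finset.mem_univ, if_true, Finset.sum_ite_irrel, Finset.sum_const_zero]
  simp only [← Finset.sum_mul, a.sum_aux₁, one_mul, Finset.mul_sum]
  exact Finset.sum_congr rfl fun _ _ => by ring

theorem law_aux₂ (W : StateMAC S₁ S₂ X₁ X₂ Y) (a : AdmissiblePair S₁ S₂ X₁ X₂ U V)
    (v : V) (s : S₂) (u : U) :
    law (W.jointLaw a) (fun ω => (ω.2.1, ω.2.2.2.2.2.1, ω.1)) (v, s, u) =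
      a.aux₂ s v * law (W.jointLaw a) (fun ω => (ω.2.2.2.2.2.1, ω.1)) (s, u) := by
  classical
  rw [W.law_jointLaw_of_states a (fun s₁ s₂ u v => (v, s₂, u)),
    W.law_jointLaw_of_states a (fun s₁ s₂ u v => (s₂, u))]
  simp only [Prod.mk.injEq, ite_and, mul_ite, mul_one, mul_zero, Finset.sum_ite_eq',
    Finset.mem_univ, if_true, Finset.sum_ite_irrel, Finset.sum_const_zero]
  simp only [← Finset.mul_sum, a.sum_aux₂, mul_one]
  rw [Finset.mul_sum]
  exact Finset.sum_congr rfl fun _ _ => by ring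

theorem law_aux (W : StateMAC S₁ S₂ X₁ X₂ Y) (a : AdmissiblePair S₁ S₂ X₁ X₂ U V)
    (u : U) (v : V) (s₁ : S₁) (s₂ : S₂) :
    law (W.jointLaw a) (fun ω => ((ω.1, ω.2.1), (ω.2.2.2.2.1, ω.2.2.2.2.2.1)))
      ((u, v), (s₁, s₂)) =
      a.aux₁ s₁ u * a.aux₂ s₂ v *
        law (W.jointLaw a) (fun ω => (ω.2.2.2.2.1, ω.2.2.2.2.2.1)) (s₁, s₂) := by
  classical
  rw [W.law_jointLaw_of_states a (fun s₁ s₂ u v => ((u, v), (s₁, s₂))),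
    W.law_jointLaw_of_states a (fun s₁ s₂ u v => (s₁, s₂))]
  simp only [Prod.mk.injEq, ite_and, mul_ite, mul_one, mul_zero, Finset.sum_ite_eq',
    Finset.mem_univ, if_true, Finset.sum_ite_irrel, Finset.sum_const_zero]
  simp only [← Finset.mul_sum, a.sum_aux₁, a.sum_aux₂, mul_one]
  ring

end SingleLetter

end StateMAC


/-! ### Rate bounds as mean log-likelihood ratios -/

namespace StateMAC

section Rates

variable {S₁ S₂ X₁ X₂ Y U V : Type*} [Fintype S₁] [Fintype S₂] [Fintype X₁] [Fintype X₂]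
  [Fintype Y] [Fintype U] [Fintype V]

/-- The decoding metric: the joint law of `(U, V, Y)`. -/
def metric (W : StateMAC S₁ S₂ X₁ X₂ Y) (a : AdmissiblePair S₁ S₂ X₁ X₂ U V) (y : Y) (u : U)
    (v : V) : ℝ :=
  law (W.jointLaw a) (fun ω => (ω.1, ω.2.1, ω.2.2.2.2.2.2)) (u, v, y)

variable (W : StateMAC S₁ S₂ X₁ X₂ Y) (a : AdmissiblePair S₁ S₂ X₁ X₂ U V)

theorem metric_nonneg (y : Y) (u : U) (v : V) : 0 ≤ W.metric a y u v :=
  law_nonneg (W.jointLaw_nonneg a) _ _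

theorem metric_pos {ω : U × V × X₁ × X₂ × S₁ × S₂ × Y} (hω : W.jointLaw a ω ≠ 0) :
    0 < W.metric a ω.2.2.2.2.2.2 ω.1 ω.2.1 :=
  law_pos (W.jointLaw_nonneg a) (fun ω => (ω.1, ω.2.1, ω.2.2.2.2.2.2)) hω

theorem sum_metric₁ (q : ℝ) (y : Y) (v : V) : ∑ u, q * W.metric a y u v =
    q * law (W.jointLaw a) (fun ω => (ω.2.2.2.2.2.2, ω.2.1)) (y, v) := by
  rw [← Finset.mul_sum]
  congr 1
  refine sum_law_eq_law _ (fun ω => ω.1) fun ω b => ?_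
  simp only [Prod.mk.injEq]
  tauto

theorem sum_metric₂ (q : ℝ) (y : Y) (u : U) : ∑ v, q * W.metric a y u v =
    q * law (W.jointLaw a) (fun ω => (ω.2.2.2.2.2.2, ω.1)) (y, u) := by
  rw [← Finset.mul_sum]
  congr 1
  refine sum_law_eq_law _ (fun ω => ω.2.1) fun ω b => ?_
  simp only [Prod.mk.injEq]
  tauto

theorem sum_metric (q q' : ℝ) (y : Y) : ∑ u, q * ∑ v, q' * W.metric a y u v =
    q * q' * law (W.jointLaw a) (fun ω => ω.2.2.2.2.2.2) y := by
  simp only [sum_metric₂]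
  simp only [← mul_assoc, ← Finset.mul_sum]
  congr 1
  refine sum_law_eq_law _ (fun ω => ω.1) fun ω b => ?_
  simp only [Prod.mk.injEq]
  tauto

theorem pairMean_add (f g : S₁ → X₁ → S₂ → X₂ → Y → U → V → ℝ) :
    W.pairMean a (fun s₁ x₁ s₂ x₂ y u v => f s₁ x₁ s₂ x₂ y u v + g s₁ x₁ s₂ x₂ y u v) =
      W.pairMean a f + W.pairMean a g := jointMean_add ..

/-- The first mean is the exponent of confusion in the first codeword, the second the exponent of
the bin size. The constant codeword probability `q` cancels between them, so the codeword law need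
not be the law of `U`. -/
theorem rate_sub₁ {q : ℝ} (hq : 0 < q) :
    condMutualInfo (W.jointLaw a) (fun ω => ω.1) (fun ω => ω.2.2.2.2.2.2) (fun ω => ω.2.1) -
      condMutualInfo (W.jointLaw a) (fun ω => ω.1) (fun ω => ω.2.2.2.2.1) (fun ω => ω.2.1) =
    -(W.pairMean a (fun _ _ _ _ y u v =>
        Real.logb 2 ((∑ u', q * W.metric a y u' v) / W.metric a y u v)) +
      W.pairMean a (fun s₁ _ _ _ _ u _ => Real.logb 2 (a.aux₁ s₁ u / q))) := by
  rw [condMutualInfo_sub (W.jointLaw_nonneg a) _ _ _ _ (fun ω => a.aux₁ ω.2.2.2.2.1 ω.1)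
    (fun ω => W.law_aux₁ a _ _ _), ← pairMean_add, pairMean_eq_sum]
  congr 1
  refine Finset.sum_congr rfl fun ω _ => ?_
  by_cases hω : W.jointLaw a ω = 0
  · simp [hω]
  have hp := W.jointLaw_nonneg a
  have l1 := W.metric_pos a hω
  have l2 := law_pos hp (fun ω => (ω.2.2.2.2.2.2, ω.2.1)) hω
  have l3 := law_pos hp (fun ω => (ω.1, ω.2.2.2.2.1, ω.2.1)) hω
  rw [law_aux₁] at l3
  have l4 : 0 < a.aux₁ ω.2.2.2.2.1 ω.1 := pos_of_mul_pos_left l3 (law_nonneg hp _ _)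
  have l5 : law (W.jointLaw a) (fun ω => (ω.1, ω.2.2.2.2.2.2, ω.2.1))
      (ω.1, ω.2.2.2.2.2.2, ω.2.1) = W.metric a ω.2.2.2.2.2.2 ω.1 ω.2.1 :=
    law_congr _ fun ω' => by simp only [Prod.mk.injEq]; tauto
  rw [l5, sum_metric₁, ← Real.logb_mul (by positivity) (by positivity)]
  congr 2
  field_simp

theorem rate_sub₂ {q : ℝ} (hq : 0 < q) :
    condMutualInfo (W.jointLaw a) (fun ω => ω.2.1) (fun ω => ω.2.2.2.2.2.2) (fun ω => ω.1) -
      condMutualInfo (W.jointLaw a) (fun ω => ω.2.1) (fun ω => ω.2.2.2.2.2.1) (fun ω => ω.1) =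
    -(W.pairMean a (fun _ _ _ _ y u v =>
        Real.logb 2 ((∑ v', q * W.metric a y u v') / W.metric a y u v)) +
      W.pairMean a (fun _ _ s₂ _ _ _ v => Real.logb 2 (a.aux₂ s₂ v / q))) := by
  rw [condMutualInfo_sub (W.jointLaw_nonneg a) _ _ _ _ (fun ω => a.aux₂ ω.2.2.2.2.2.1 ω.2.1)
    (fun ω => W.law_aux₂ a _ _ _), ← pairMean_add, pairMean_eq_sum]
  congr 1
  refine Finset.sum_congr rfl fun ω _ => ?_
  by_cases hω : W.jointLaw a ω = 0
  · simp [hω]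
  have hp := W.jointLaw_nonneg a
  have l1 := W.metric_pos a hω
  have l2 := law_pos hp (fun ω => (ω.2.2.2.2.2.2, ω.1)) hω
  have l3 := law_pos hp (fun ω => (ω.2.1, ω.2.2.2.2.2.1, ω.1)) hω
  rw [law_aux₂] at l3
  have l4 : 0 < a.aux₂ ω.2.2.2.2.2.1 ω.2.1 := pos_of_mul_pos_left l3 (law_nonneg hp _ _)
  have l5 : law (W.jointLaw a) (fun ω => (ω.2.1, ω.2.2.2.2.2.2, ω.1))
      (ω.2.1, ω.2.2.2.2.2.2, ω.1) = W.metric a ω.2.2.2.2.2.2 ω.1 ω.2.1 :=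
    law_congr _ fun ω' => by simp only [Prod.mk.injEq]; tauto
  rw [l5, sum_metric₂, ← Real.logb_mul (by positivity) (by positivity)]
  congr 2
  field_simp

/-- Competitors with two fresh codewords range over both bins, so both bin exponents are paid. -/
theorem rate_sub {q₁ q₂ : ℝ} (hq₁ : 0 < q₁) (hq₂ : 0 < q₂) :
    mutualInfo (W.jointLaw a) (fun ω => (ω.1, ω.2.1)) (fun ω => ω.2.2.2.2.2.2) -
      mutualInfo (W.jointLaw a) (fun ω => (ω.1, ω.2.1))
        (fun ω => (ω.2.2.2.2.1, ω.2.2.2.2.2.1)) =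
    -(W.pairMean a (fun _ _ _ _ y u v =>
        Real.logb 2 ((∑ u', q₁ * ∑ v', q₂ * W.metric a y u' v') / W.metric a y u v)) +
      W.pairMean a (fun s₁ _ _ _ _ u _ => Real.logb 2 (a.aux₁ s₁ u / q₁)) +
      W.pairMean a (fun _ _ s₂ _ _ _ v => Real.logb 2 (a.aux₂ s₂ v / q₂))) := by
  rw [mutualInfo_sub (W.jointLaw_nonneg a) _ _ _
    (fun ω => a.aux₁ ω.2.2.2.2.1 ω.1 * a.aux₂ ω.2.2.2.2.2.1 ω.2.1)
    (fun ω => W.law_aux a _ _ _ _), ← pairMean_add, ← pairMean_add, pairMean_eq_sum]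
  congr 1
  refine Finset.sum_congr rfl fun ω _ => ?_
  by_cases hω : W.jointLaw a ω = 0
  · simp [hω]
  have hp := W.jointLaw_nonneg a
  have l1 := W.metric_pos a hω
  have l2 := law_pos hp (fun ω => ω.2.2.2.2.2.2) hω
  have l3 := law_pos hp (fun ω => (ω.1, ω.2.2.2.2.1, ω.2.1)) hω
  have l3' := law_pos hp (fun ω => (ω.2.1, ω.2.2.2.2.2.1, ω.1)) hω
  rw [law_aux₁] at l3
  rw [law_aux₂] at l3'
  have l4 : 0 < a.aux₁ ω.2.2.2.2.1 ω.1 := pos_of_mul_pos_left l3 (law_nonneg hp _ _)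
  have l4' : 0 < a.aux₂ ω.2.2.2.2.2.1 ω.2.1 := pos_of_mul_pos_left l3' (law_nonneg hp _ _)
  have l5 : law (W.jointLaw a) (fun ω => ((ω.1, ω.2.1), ω.2.2.2.2.2.2))
      ((ω.1, ω.2.1), ω.2.2.2.2.2.2) = W.metric a ω.2.2.2.2.2.2 ω.1 ω.2.1 :=
    law_congr _ fun ω' => by simp only [Prod.mk.injEq]; tauto
  rw [l5, sum_metric, ← Real.logb_mul (by positivity) (by positivity),
    ← Real.logb_mul (by positivity) (by positivity)]
  congr 2
  field_simp

/-- From `log t ≥ 1 - 1/t`; at `x = 0` the right side is 0. Summed over an alphabet, it gives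
nonnegativity of divergence. -/
theorem sub_div_log_le_mul_logb {x q : ℝ} (hx : 0 ≤ x) (hq : 0 < q) :
    (x - q) / Real.log 2 ≤ x * Real.logb 2 (x / q) := by
  have h2 : 0 < Real.log 2 := Real.log_pos one_lt_two
  rw [Real.logb, ← mul_div_assoc]
  refine div_le_div_of_nonneg_right ?_ h2.le
  rcases hx.eq_or_lt with rfl | hx
  · simpa using hq.le
  have h := mul_le_mul_of_nonneg_left (Real.one_sub_inv_le_log_of_pos (div_pos hx hq)) hx.le
  calc x - q = x * (1 - (x / q)⁻¹) := by field_simp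
    _ ≤ _ := h

theorem sum_mul_logb_nonneg {x : U → ℝ} (hx : ∀ u, 0 ≤ x u) (hx1 : ∑ u, x u = 1) {q : ℝ}
    (hq : 0 < q) (hq1 : ∑ _u : U, q = 1) : 0 ≤ ∑ u, x u * Real.logb 2 (x u / q) := by
  calc (0 : ℝ) = ∑ u, (x u - q) / Real.log 2 := by
        rw [← Finset.sum_div, Finset.sum_sub_distrib, hx1, hq1, sub_self, zero_div]
    _ ≤ _ := Finset.sum_le_sum fun u _ => sub_div_log_le_mul_logb (hx u) hq

/-- A mean divergence from the uniform law. Its sign makes the bin exponent nonnegative, so that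
rounding the bin size up at most doubles it. -/
theorem pairMean_logb_aux₁_nonneg {q : ℝ} (hq : 0 < q) (hq1 : ∑ _u : U, q = 1) :
    0 ≤ W.pairMean a (fun s₁ _ _ _ _ u _ => Real.logb 2 (a.aux₁ s₁ u / q)) := by
  rw [W.pairMean_eq_of_states a fun s₁ _ u _ => Real.logb 2 (a.aux₁ s₁ u / q)]
  refine Finset.sum_nonneg fun s₁ _ => Finset.sum_nonneg fun s₂ _ =>
    mul_nonneg (W.state_mem.1 _) ?_
  refine (sum_mul_logb_nonneg (fun u => Finset.sum_nonneg fun x _ => (a.kernel₁_mem s₁).1 (u, x))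
    (a.sum_aux₁ s₁) hq hq1).trans_eq ?_
  refine Finset.sum_congr rfl fun u _ => ?_
  rw [← Finset.sum_mul, ← Finset.mul_sum, a.sum_aux₂, mul_one]
  rfl

theorem pairMean_logb_aux₂_nonneg {q : ℝ} (hq : 0 < q) (hq1 : ∑ _v : V, q = 1) :
    0 ≤ W.pairMean a (fun _ _ s₂ _ _ _ v => Real.logb 2 (a.aux₂ s₂ v / q)) := by
  rw [W.pairMean_eq_of_states a fun _ s₂ _ v => Real.logb 2 (a.aux₂ s₂ v / q)]
  refine Finset.sum_nonneg fun s₁ _ => Finset.sum_nonneg fun s₂ _ =>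
    mul_nonneg (W.state_mem.1 _) ?_
  refine (sum_mul_logb_nonneg (fun u => Finset.sum_nonneg fun x _ => (a.kernel₂_mem s₂).1 (u, x))
    (a.sum_aux₂ s₂) hq hq1).trans_eq ?_
  rw [Finset.sum_comm]
  refine Finset.sum_congr rfl fun u _ => ?_
  simp only [mul_assoc]
  rw [← Finset.sum_mul, a.sum_aux₁, one_mul]
  rfl

end Rates

/-! ### Exponential decay of moments -/

section Moments

/-- As a function of `t` the left side equals 1 at 0, and its derivative there is `log 2` times the
quantity assumed negative. -/
theorem exists_rpow_moment_lt_one {Ω : Type*} [Fintype Ω] {p r : Ω → ℝ} {c : ℝ}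
    (hp1 : ∑ ω, p ω = 1) (hr : ∀ ω, p ω ≠ 0 → 0 < r ω)
    (h : ∑ ω, p ω * Real.logb 2 (r ω) + c < 0) :
    ∃ t : ℝ, 0 < t ∧ t ≤ 1 ∧ (2 : ℝ) ^ (c * t) * ∑ ω, p ω * r ω ^ t < 1 := by
  set F : ℝ → ℝ := fun t => (2 : ℝ) ^ (c * t) * ∑ ω, p ω * r ω ^ t with hF
  have h2 : 0 < Real.log 2 := Real.log_pos one_lt_two
  have hF0 : F 0 = 1 := by simp [hF, hp1]
  have hd1 : HasDerivAt (fun t : ℝ => (2 : ℝ) ^ (c * t)) (Real.log 2 * c) 0 := by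
    have := ((hasDerivAt_id (0 : ℝ)).const_mul c).const_rpow (a := 2) two_pos
    simpa using this
  have hd2 : HasDerivAt (fun t : ℝ => ∑ ω, p ω * r ω ^ t) (∑ ω, p ω * Real.log (r ω)) 0 := by
    refine HasDerivAt.fun_sum fun ω _ => ?_
    by_cases hω : p ω = 0
    · simpa [hω] using hasDerivAt_const (0 : ℝ) (0 : ℝ)
    · have := ((hasDerivAt_id (0 : ℝ)).const_rpow (hr ω hω)).const_mul (p ω)
      simpa using this
  have hd : HasDerivAt F (Real.log 2 * (∑ ω, p ω * Real.logb 2 (r ω) + c)) 0 := by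
    have := hd1.mul hd2
    refine this.congr_deriv ?_
    have e : ∀ ω, p ω * Real.log (r ω) = Real.log 2 * (p ω * Real.logb 2 (r ω)) := fun ω => by
      rw [Real.logb]; field_simp
    simp only [e, ← Finset.mul_sum, Real.rpow_zero, mul_one, hp1, mul_zero]
    ring
  have hs := (hasDerivAt_iff_tendsto_slope.1 hd).eventually_lt_const (mul_neg_of_pos_of_neg h2 h)
  have hs' := hs.filter_mono (nhdsWithin_mono (0 : ℝ) fun t (ht : t ∈ Set.Ioi 0) => ne_of_gt ht)
  have h1 : ∀ᶠ t : ℝ in nhdsWithin 0 (Set.Ioi 0), t ≤ 1 :=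
    (eventually_le_nhds one_pos).filter_mono nhdsWithin_le_nhds
  obtain ⟨t, ⟨hst, ht1⟩, ht0⟩ := ((hs'.and h1).and self_mem_nhdsWithin).exists
  refine ⟨t, ht0, ht1, ?_⟩
  rw [slope_def_field, sub_zero, div_neg_iff] at hst
  have ht0' : (0 : ℝ) < t := ht0
  rcases hst with hst | hst
  · linarith [hst.2]
  · have := hst.1
    rw [hF0] at this
    linarith

variable {S₁ S₂ X₁ X₂ Y : Type*} [Fintype S₁] [Fintype S₂] [Fintype X₁] [Fintype X₂]
  [Fintype Y]

theorem pairMean_one {U V : Type*} [Fintype U] [Fintype V] (W : StateMAC S₁ S₂ X₁ X₂ Y)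
    (a : AdmissiblePair S₁ S₂ X₁ X₂ U V) : W.pairMean a (fun _ _ _ _ _ _ _ => 1) = 1 := by
  refine jointMean_one ?_ a.sum_aux₁ a.sum_aux₂ fun _ _ _ _ => (W.trans_mem ..).2
  rw [← Fintype.sum_prod_type']
  exact W.state_mem.2

variable {J : Type*} [Fintype J] {U V : J → Type*} [∀ j, Fintype (U j)] [∀ j, Fintype (V j)]

/-- The time-sharing index becomes part of the probability space, so one exponent `t` serves the
whole mixture and only averaged rate bounds matter. -/
theorem sum_mul_pairMean (W : StateMAC S₁ S₂ X₁ X₂ Y) (lam : J → ℝ)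
    (a : ∀ j, AdmissiblePair S₁ S₂ X₁ X₂ (U j) (V j))
    (f : ∀ j, S₁ → X₁ → S₂ → X₂ → Y → U j → V j → ℝ) :
    ∑ j, lam j * W.pairMean (a j) (f j) =
      ∑ ω : (j : J) × (U j × V j × X₁ × X₂ × S₁ × S₂ × Y), lam ω.1 * W.jointLaw (a ω.1) ω.2 *
        f ω.1 ω.2.2.2.2.2.1 ω.2.2.2.1 ω.2.2.2.2.2.2.1 ω.2.2.2.2.1 ω.2.2.2.2.2.2.2 ω.2.1 ω.2.2.1 := by
  rw [Fintype.sum_sigma]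
  refine Finset.sum_congr rfl fun j _ => ?_
  rw [pairMean_eq_sum, Finset.mul_sum]
  exact Finset.sum_congr rfl fun ω _ => (mul_assoc ..).symm

theorem exists_tendsto_moment (W : StateMAC S₁ S₂ X₁ X₂ Y) {lam : J → ℝ} (hlam : ∀ j, 0 ≤ lam j)
    (hlam' : ∑ j, lam j = 1) (a : ∀ j, AdmissiblePair S₁ S₂ X₁ X₂ (U j) (V j))
    (r : ∀ j, S₁ → X₁ → S₂ → X₂ → Y → U j → V j → ℝ)
    (hr0 : ∀ j s₁ x₁ s₂ x₂ y u v, 0 ≤ r j s₁ x₁ s₂ x₂ y u v)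
    (hr : ∀ j ω, W.jointLaw (a j) ω ≠ 0 →
      0 < r j ω.2.2.2.2.1 ω.2.2.1 ω.2.2.2.2.2.1 ω.2.2.2.1 ω.2.2.2.2.2.2 ω.1 ω.2.1)
    {scale : ℕ → ℝ} (hs : ∀ n, 0 ≤ scale n) (h : (∀ n, scale n = 0) ∨ ∃ C c : ℝ,
      0 ≤ C ∧ (∀ n : ℕ, scale n ≤ C * (2 : ℝ) ^ (n * c)) ∧
      ∑ j, lam j * W.pairMean (a j) (fun s₁ x₁ s₂ x₂ y u v =>
        Real.logb 2 (r j s₁ x₁ s₂ x₂ y u v)) + c < 0) :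
    ∃ t ∈ Set.Icc (0 : ℝ) 1, Filter.Tendsto (fun n => scale n ^ t *
      (∑ j, lam j * W.pairMean (a j) (fun s₁ x₁ s₂ x₂ y u v => r j s₁ x₁ s₂ x₂ y u v ^ t)) ^ n)
      Filter.atTop (nhds 0) := by
  rcases h with h | ⟨C, c, hC, hsc, hneg⟩
  -- The exponent must be nonzero here, because `0 ^ 0 = 1`.
  · exact ⟨1, by simp, by simp [h]⟩
  rw [sum_mul_pairMean] at hneg
  have htot : ∑ ω : (j : J) × (U j × V j × X₁ × X₂ × S₁ × S₂ × Y),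
      lam ω.1 * W.jointLaw (a ω.1) ω.2 = 1 := by
    have := W.sum_mul_pairMean lam a fun _ _ _ _ _ _ _ _ => 1
    simp only [pairMean_one, mul_one, hlam'] at this
    exact this.symm
  obtain ⟨t, ht0, ht1, hlt⟩ := exists_rpow_moment_lt_one htot
    (fun ω hω => hr ω.1 ω.2 (right_ne_zero_of_mul hω)) hneg
  refine ⟨t, ⟨ht0.le, ht1⟩, ?_⟩
  rw [← W.sum_mul_pairMean lam a fun j s₁ x₁ s₂ x₂ y u v => r j s₁ x₁ s₂ x₂ y u v ^ t] at hlt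
  set G := ∑ j, lam j * W.pairMean (a j) fun s₁ x₁ s₂ x₂ y u v => r j s₁ x₁ s₂ x₂ y u v ^ t with hG
  have hG0 : 0 ≤ G := Finset.sum_nonneg fun j _ => mul_nonneg (hlam j) <| by
    rw [pairMean_eq_sum]
    exact Finset.sum_nonneg fun ω _ => mul_nonneg (W.jointLaw_nonneg _ _)
      (Real.rpow_nonneg (hr0 ..) _)
  have hlim : Filter.Tendsto (fun n : ℕ => C ^ t * ((2 : ℝ) ^ (c * t) * G) ^ n)
      Filter.atTop (nhds 0) := by
    simpa using (tendsto_pow_atTop_nhds_zero_of_lt_one (by positivity) hlt).const_mul (C ^ t)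
  refine squeeze_zero (fun n => mul_nonneg (Real.rpow_nonneg (hs n) _) (pow_nonneg hG0 n))
    (fun n => ?_) hlim
  calc scale n ^ t * G ^ n ≤ (C * (2 : ℝ) ^ (n * c)) ^ t * G ^ n :=
        mul_le_mul_of_nonneg_right (Real.rpow_le_rpow (hs n) (hsc n) ht0.le) (pow_nonneg hG0 n)
    _ = C ^ t * ((2 : ℝ) ^ (c * t) * G) ^ n := by
        rw [Real.mul_rpow hC (by positivity), ← Real.rpow_mul (by norm_num), mul_pow,
          ← Real.rpow_natCast ((2 : ℝ) ^ (c * t)), ← Real.rpow_mul (by norm_num)]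
        ring_nf

end Moments

end StateMAC


/-! ### Choice of bin sizes and achievability -/

namespace StateMAC

section Achievability

variable {S₁ S₂ X₁ X₂ Y : Type*} [Fintype S₁] [Fintype S₂] [Fintype X₁] [Fintype X₂]
  [Fintype Y]

theorem le_natCeil_two_rpow_le {R : ℝ} (hR : 0 ≤ R) (n : ℕ) :
    (2 : ℝ) ^ (n * R) ≤ ⌈(2 : ℝ) ^ (n * R)⌉₊ ∧
      (⌈(2 : ℝ) ^ (n * R)⌉₊ : ℝ) ≤ 2 * (2 : ℝ) ^ (n * R) := by
  have h1 : (1 : ℝ) ≤ (2 : ℝ) ^ (n * R) := Real.one_le_rpow (by norm_num) (by positivity)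
  refine ⟨Nat.le_ceil _, ?_⟩
  linarith [Nat.ceil_lt_add_one (zero_le_one.trans h1)]

theorem errorProb_nonneg {X₁ X₂ : Type*} (W : StateMAC S₁ S₂ X₁ X₂ Y) {n M₁ M₂ : ℕ}
    (c : MACCode S₁ S₂ X₁ X₂ Y n M₁ M₂) : 0 ≤ W.errorProb c := by
  refine Finset.sum_nonneg fun _ _ => Finset.sum_nonneg fun _ _ => Finset.sum_nonneg fun _ _ =>
    Finset.sum_nonneg fun _ _ => Finset.sum_nonneg fun _ _ => ?_
  refine mul_nonneg (mul_nonneg (mul_nonneg (by positivity) ?_) ?_) (by split_ifs <;> norm_num)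
  · exact Finset.prod_nonneg fun _ _ => W.state_mem.1 _
  · exact Finset.prod_nonneg fun _ _ => (W.trans_mem ..).1 _

theorem exists_pos_slack {p : Prop} {x y : ℝ} (h : p ∨ x < y) : ∃ δ > 0, p ∨ x + δ < y := by
  rcases h with h | h
  · exact ⟨1, one_pos, Or.inl h⟩
  · exact ⟨(y - x) / 2, by linarith, Or.inr (by linarith)⟩

/-- The rates bounded by the time-sharing averages of the information quantities are achievable.
A zero rate is not subject to its individual bound. -/
theorem achievable_of_lt (W : StateMAC S₁ S₂ X₁ X₂ Y) {J : Type*} [Fintype J] {lam : J → ℝ}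
    (hlam : ∀ j, 0 ≤ lam j) (hlam' : ∑ j, lam j = 1) {U V : J → Type*} [∀ j, Fintype (U j)]
    [∀ j, Fintype (V j)] (a : ∀ j, AdmissiblePair S₁ S₂ X₁ X₂ (U j) (V j)) {T : J → ℝ × ℝ}
    (hT : ∀ j, T j ∈ W.rateConstraints (a j)) {R : ℝ × ℝ} (hR₁ : 0 ≤ R.1) (hR₂ : 0 ≤ R.2)
    (h₁ : R.1 = 0 ∨ R.1 < ∑ j, lam j * (T j).1) (h₂ : R.2 = 0 ∨ R.2 < ∑ j, lam j * (T j).2)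
    (h₁₂ : (R.1 = 0 ∧ R.2 = 0) ∨ R.1 + R.2 < ∑ j, lam j * ((T j).1 + (T j).2)) :
    W.Achievable R := by
  obtain ⟨⟨s₁, s₂⟩⟩ : Nonempty (S₁ × S₂) := by
    by_contra hne
    rw [not_nonempty_iff] at hne
    simpa using W.state_mem.2
  have hne : ∀ j, Nonempty (U j × X₁) ∧ Nonempty (V j × X₂) := fun j => by
    constructor
    · by_contra hne
      rw [not_nonempty_iff] at hne
      simpa using ((a j).kernel₁_mem s₁).2
    · by_contra hne
      rw [not_nonempty_iff] at hne
      simpa using ((a j).kernel₂_mem s₂).2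
  have hJ : Nonempty J := by
    by_contra hne
    rw [not_nonempty_iff] at hne
    simp at hlam'
  have hX₁ : Nonempty X₁ := (hne hJ.some).1.map Prod.snd
  have hX₂ : Nonempty X₂ := (hne hJ.some).2.map Prod.snd
  have hU : ∀ j, Nonempty (U j) := fun j => (hne j).1.map Prod.fst
  have hV : ∀ j, Nonempty (V j) := fun j => (hne j).2.map Prod.fst
  -- Codewords are uniform, which guarantees the strict positivity required of the codeword laws.
  set q₁ : J → ℝ := fun j => (Fintype.card (U j) : ℝ)⁻¹ with hq₁
  set q₂ : J → ℝ := fun j => (Fintype.card (V j) : ℝ)⁻¹ with hq₂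
  have hq₁0 : ∀ j, 0 < q₁ j := fun j => by
    have := Fintype.card_pos (α := U j)
    simp only [hq₁]; positivity
  have hq₂0 : ∀ j, 0 < q₂ j := fun j => by
    have := Fintype.card_pos (α := V j)
    simp only [hq₂]; positivity
  have hq₁1 : ∀ j, ∑ _u : U j, q₁ j = 1 := fun j => by simp [hq₁]
  have hq₂1 : ∀ j, ∑ _v : V j, q₂ j = 1 := fun j => by simp [hq₂]
  -- the five single-letter log-likelihood ratios
  set A₁ := ∑ j, lam j * W.pairMean (a j) (fun s₁ _ _ _ _ u _ =>
    Real.logb 2 ((a j).aux₁ s₁ u / q₁ j)) with hA₁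
  set A₂ := ∑ j, lam j * W.pairMean (a j) (fun _ _ s₂ _ _ _ v =>
    Real.logb 2 ((a j).aux₂ s₂ v / q₂ j)) with hA₂
  set B₁ := ∑ j, lam j * W.pairMean (a j) (fun _ _ _ _ y u v =>
    Real.logb 2 ((∑ u', q₁ j * W.metric (a j) y u' v) / W.metric (a j) y u v)) with hB₁
  set B₂ := ∑ j, lam j * W.pairMean (a j) (fun _ _ _ _ y u v =>
    Real.logb 2 ((∑ v', q₂ j * W.metric (a j) y u v') / W.metric (a j) y u v)) with hB₂
  set B₁₂ := ∑ j, lam j * W.pairMean (a j) (fun _ _ _ _ y u v =>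
    Real.logb 2 ((∑ u', q₁ j * ∑ v', q₂ j * W.metric (a j) y u' v') /
      W.metric (a j) y u v)) with hB₁₂
  have hA₁0 : 0 ≤ A₁ := Finset.sum_nonneg fun j _ =>
    mul_nonneg (hlam j) (W.pairMean_logb_aux₁_nonneg (a j) (hq₁0 j) (hq₁1 j))
  have hA₂0 : 0 ≤ A₂ := Finset.sum_nonneg fun j _ =>
    mul_nonneg (hlam j) (W.pairMean_logb_aux₂_nonneg (a j) (hq₂0 j) (hq₂1 j))
  have hT₁ : ∑ j, lam j * (T j).1 ≤ -(B₁ + A₁) := by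
    rw [hB₁, hA₁, ← Finset.sum_add_distrib, ← Finset.sum_neg_distrib]
    refine Finset.sum_le_sum fun j _ => ?_
    rw [← mul_add, ← mul_neg, ← W.rate_sub₁ (a j) (hq₁0 j)]
    exact mul_le_mul_of_nonneg_left (hT j).1 (hlam j)
  have hT₂ : ∑ j, lam j * (T j).2 ≤ -(B₂ + A₂) := by
    rw [hB₂, hA₂, ← Finset.sum_add_distrib, ← Finset.sum_neg_distrib]
    refine Finset.sum_le_sum fun j _ => ?_
    rw [← mul_add, ← mul_neg, ← W.rate_sub₂ (a j) (hq₂0 j)]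
    exact mul_le_mul_of_nonneg_left (hT j).2.1 (hlam j)
  have hT₁₂ : ∑ j, lam j * ((T j).1 + (T j).2) ≤ -(B₁₂ + A₁ + A₂) := by
    rw [hB₁₂, hA₁, hA₂, ← Finset.sum_add_distrib, ← Finset.sum_add_distrib,
      ← Finset.sum_neg_distrib]
    refine Finset.sum_le_sum fun j _ => ?_
    rw [← mul_add, ← mul_add, ← mul_neg, ← W.rate_sub (a j) (hq₁0 j) (hq₂0 j)]
    exact mul_le_mul_of_nonneg_left (hT j).2.2 (hlam j)
  clear_value A₁ A₂ B₁ B₂ B₁₂ q₁ q₂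
  obtain ⟨δ₁, hδ₁, h₁⟩ := exists_pos_slack h₁
  obtain ⟨δ₂, hδ₂, h₂⟩ := exists_pos_slack h₂
  obtain ⟨δ₃, hδ₃, h₁₂⟩ := exists_pos_slack h₁₂
  -- The third slack is halved because the sum bound has to absorb the excess of both bins.
  set δ := min δ₁ (min δ₂ (δ₃ / 2)) with hδ
  have hδ0 : 0 < δ := lt_min hδ₁ (lt_min hδ₂ (half_pos hδ₃))
  have hδ₁' : δ ≤ δ₁ := min_le_left _ _
  have hδ₂' : δ ≤ δ₂ := (min_le_right _ _).trans (min_le_left _ _)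
  have hδ₃' : δ ≤ δ₃ / 2 := (min_le_right _ _).trans (min_le_right _ _)
  -- The bin exponent lies just above `A₁`, where the covering moment starts to decay.
  set ℓ₁ := A₁ + δ with hℓ₁
  set ℓ₂ := A₂ + δ with hℓ₂
  have hℓ₁0 : 0 ≤ ℓ₁ := add_nonneg hA₁0 hδ0.le
  have hℓ₂0 : 0 ≤ ℓ₂ := add_nonneg hA₂0 hδ0.le
  clear_value ℓ₁ ℓ₂ δ
  let M₁ : ℕ → ℕ := fun n => ⌈(2 : ℝ) ^ ((n : ℝ) * R.1)⌉₊
  let M₂ : ℕ → ℕ := fun n => ⌈(2 : ℝ) ^ ((n : ℝ) * R.2)⌉₊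
  let L₁ : ℕ → ℕ := fun n => ⌈(2 : ℝ) ^ ((n : ℝ) * ℓ₁)⌉₊
  let L₂ : ℕ → ℕ := fun n => ⌈(2 : ℝ) ^ ((n : ℝ) * ℓ₂)⌉₊
  have hpos : ∀ (R : ℝ) (n : ℕ), 0 < ⌈(2 : ℝ) ^ ((n : ℝ) * R)⌉₊ := fun R n =>
    Nat.ceil_pos.2 (by positivity)
  have hM₁ : ∀ n, (1 : ℝ) ≤ M₁ n := fun n => by exact_mod_cast hpos R.1 n
  have hM₂ : ∀ n, (1 : ℝ) ≤ M₂ n := fun n => by exact_mod_cast hpos R.2 n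
  have hL₁ : ∀ n, (1 : ℝ) ≤ L₁ n := fun n => by exact_mod_cast hpos ℓ₁ n
  have hL₂ : ∀ n, (1 : ℝ) ≤ L₂ n := fun n => by exact_mod_cast hpos ℓ₂ n
  have bM₁ : ∀ n, (M₁ n : ℝ) ≤ 2 * (2 : ℝ) ^ (n * R.1) := fun n => (le_natCeil_two_rpow_le hR₁ n).2
  have bM₂ : ∀ n, (M₂ n : ℝ) ≤ 2 * (2 : ℝ) ^ (n * R.2) := fun n => (le_natCeil_two_rpow_le hR₂ n).2
  have bL₁ : ∀ n, (L₁ n : ℝ) ≤ 2 * (2 : ℝ) ^ (n * ℓ₁) := fun n => (le_natCeil_two_rpow_le hℓ₁0 n).2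
  have bL₂ : ∀ n, (L₂ n : ℝ) ≤ 2 * (2 : ℝ) ^ (n * ℓ₂) := fun n => (le_natCeil_two_rpow_le hℓ₂0 n).2
  have hd := fun j => W.metric_nonneg (a j)
  have hdp := fun j => @metric_pos _ _ _ _ _ _ _ _ _ _ _ _ _ _ W (a j)
  have hk₁ : ∀ j s u, 0 ≤ (a j).aux₁ s u := fun j s u =>
    Finset.sum_nonneg fun x _ => ((a j).kernel₁_mem s).1 _
  have hk₂ : ∀ j s u, 0 ≤ (a j).aux₂ s u := fun j s u =>
    Finset.sum_nonneg fun x _ => ((a j).kernel₂_mem s).1 _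
  have hk₁p : ∀ j ω, W.jointLaw (a j) ω ≠ 0 → 0 < (a j).aux₁ ω.2.2.2.2.1 ω.1 := fun j ω hω => by
    refine (hk₁ ..).lt_of_ne' fun h0 => hω ?_
    have := (Finset.sum_eq_zero_iff_of_nonneg fun x _ => ((a j).kernel₁_mem _).1 _).1 h0
      ω.2.2.1 (Finset.mem_univ _)
    simp [jointLaw, this]
  have hk₂p : ∀ j ω, W.jointLaw (a j) ω ≠ 0 → 0 < (a j).aux₂ ω.2.2.2.2.2.1 ω.2.1 := fun j ω hω => by
    refine (hk₂ ..).lt_of_ne' fun h0 => hω ?_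
    have := (Finset.sum_eq_zero_iff_of_nonneg fun x _ => ((a j).kernel₂_mem _).1 _).1 h0
      ω.2.2.2.1 (Finset.mem_univ _)
    simp [jointLaw, this]
  have hsum₁ : ∀ j y v, 0 ≤ ∑ u', q₁ j * W.metric (a j) y u' v := fun j y v =>
    Finset.sum_nonneg fun _ _ => mul_nonneg (hq₁0 j).le (hd ..)
  have hsum₂ : ∀ j y u, 0 ≤ ∑ v', q₂ j * W.metric (a j) y u v' := fun j y v =>
    Finset.sum_nonneg fun _ _ => mul_nonneg (hq₂0 j).le (hd ..)
  have hsum₁₂ : ∀ j y, 0 ≤ ∑ u', q₁ j * ∑ v', q₂ j * W.metric (a j) y u' v' := fun j y =>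
    Finset.sum_nonneg fun _ _ => mul_nonneg (hq₁0 j).le (hsum₂ ..)
  have hsum₁p : ∀ j ω, W.jointLaw (a j) ω ≠ 0 →
      0 < ∑ u', q₁ j * W.metric (a j) ω.2.2.2.2.2.2 u' ω.2.1 := fun j ω hω =>
    Finset.sum_pos' (fun _ _ => mul_nonneg (hq₁0 j).le (hd ..))
      ⟨ω.1, Finset.mem_univ _, mul_pos (hq₁0 j) (hdp j hω)⟩
  have hsum₂p : ∀ j ω, W.jointLaw (a j) ω ≠ 0 →
      0 < ∑ v', q₂ j * W.metric (a j) ω.2.2.2.2.2.2 ω.1 v' := fun j ω hω =>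
    Finset.sum_pos' (fun _ _ => mul_nonneg (hq₂0 j).le (hd ..))
      ⟨ω.2.1, Finset.mem_univ _, mul_pos (hq₂0 j) (hdp j hω)⟩
  obtain ⟨t₁, ht₁, lim₁⟩ := W.exists_tendsto_moment hlam hlam' a
    (fun j s₁ _ _ _ _ u _ => (a j).aux₁ s₁ u / q₁ j)
    (fun j _ _ _ _ _ _ _ => div_nonneg (hk₁ ..) (hq₁0 j).le)
    (fun j ω hω => div_pos (hk₁p j ω hω) (hq₁0 j))
    (scale := fun n => 1 / (L₁ n : ℝ)) (fun n => by positivity)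
    (Or.inr ⟨1, -ℓ₁, zero_le_one, fun n => by
      rw [one_mul, mul_neg, Real.rpow_neg two_pos.le, one_div]
      exact inv_anti₀ (by positivity) (le_natCeil_two_rpow_le hℓ₁0 n).1, by
      rw [← hA₁, hℓ₁]; linarith⟩)
  obtain ⟨t₂, ht₂, lim₂⟩ := W.exists_tendsto_moment hlam hlam' a
    (fun j _ _ s₂ _ _ _ v => (a j).aux₂ s₂ v / q₂ j)
    (fun j _ _ _ _ _ _ _ => div_nonneg (hk₂ ..) (hq₂0 j).le)
    (fun j ω hω => div_pos (hk₂p j ω hω) (hq₂0 j))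
    (scale := fun n => 1 / (L₂ n : ℝ)) (fun n => by positivity)
    (Or.inr ⟨1, -ℓ₂, zero_le_one, fun n => by
      rw [one_mul, mul_neg, Real.rpow_neg two_pos.le, one_div]
      exact inv_anti₀ (by positivity) (le_natCeil_two_rpow_le hℓ₂0 n).1, by
      rw [← hA₂, hℓ₂]; linarith⟩)
  have two_add : ∀ (n : ℕ) (x y : ℝ), (2 : ℝ) ^ (n * (x + y)) = 2 ^ (n * x) * 2 ^ (n * y) :=
    fun n x y => by rw [mul_add, Real.rpow_add two_pos]
  obtain ⟨t₃, ht₃, lim₃⟩ := W.exists_tendsto_moment hlam hlam' a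
    (fun j _ _ _ _ y u v => (∑ u', q₁ j * W.metric (a j) y u' v) / W.metric (a j) y u v)
    (fun j _ _ _ _ _ _ _ => div_nonneg (hsum₁ ..) (hd ..))
    (fun j ω hω => div_pos (hsum₁p j ω hω) (hdp j hω))
    (scale := fun n => ((M₁ n : ℝ) - 1) * L₁ n)
    (fun n => mul_nonneg (sub_nonneg.2 (hM₁ n)) (by positivity)) (by
      -- At rate zero there is one message and the factor `M₁ n - 1` vanishes. Otherwise each of the
      -- two ceilings costs a factor 2, hence 4; the sum bound has four ceilings, hence 16.
      refine h₁.imp (fun h n => by simp [M₁, h]) fun h => ⟨4, R.1 + ℓ₁, by norm_num, fun n => ?_, ?_⟩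
      · rw [two_add]
        calc ((M₁ n : ℝ) - 1) * L₁ n ≤ (2 * (2 : ℝ) ^ (n * R.1)) * (2 * (2 : ℝ) ^ (n * ℓ₁)) :=
              mul_le_mul (by linarith [bM₁ n]) (bL₁ n) (by positivity) (by positivity)
          _ = _ := by ring
      · rw [← hB₁, hℓ₁]; linarith)
  obtain ⟨t₄, ht₄, lim₄⟩ := W.exists_tendsto_moment hlam hlam' a
    (fun j _ _ _ _ y u v => (∑ v', q₂ j * W.metric (a j) y u v') / W.metric (a j) y u v)
    (fun j _ _ _ _ _ _ _ => div_nonneg (hsum₂ ..) (hd ..))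
    (fun j ω hω => div_pos (hsum₂p j ω hω) (hdp j hω))
    (scale := fun n => ((M₂ n : ℝ) - 1) * L₂ n)
    (fun n => mul_nonneg (sub_nonneg.2 (hM₂ n)) (by positivity)) (by
      refine h₂.imp (fun h n => by simp [M₂, h]) fun h => ⟨4, R.2 + ℓ₂, by norm_num, fun n => ?_, ?_⟩
      · rw [two_add]
        calc ((M₂ n : ℝ) - 1) * L₂ n ≤ (2 * (2 : ℝ) ^ (n * R.2)) * (2 * (2 : ℝ) ^ (n * ℓ₂)) :=
              mul_le_mul (by linarith [bM₂ n]) (bL₂ n) (by positivity) (by positivity)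
          _ = _ := by ring
      · rw [← hB₂, hℓ₂]; linarith)
  obtain ⟨t₅, ht₅, lim₅⟩ := W.exists_tendsto_moment hlam hlam' a
    (fun j _ _ _ _ y u v =>
      (∑ u', q₁ j * ∑ v', q₂ j * W.metric (a j) y u' v') / W.metric (a j) y u v)
    (fun j _ _ _ _ _ _ _ => div_nonneg (hsum₁₂ ..) (hd ..))
    (fun j ω hω => div_pos (Finset.sum_pos' (fun _ _ => mul_nonneg (hq₁0 j).le (hsum₂ ..))
      ⟨ω.1, Finset.mem_univ _, mul_pos (hq₁0 j) (hsum₂p j ω hω)⟩) (hdp j hω))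
    (scale := fun n => ((M₁ n : ℝ) * M₂ n - 1) * L₁ n * L₂ n)
    (fun n => mul_nonneg (mul_nonneg (by nlinarith [hM₁ n, hM₂ n]) (by positivity))
      (by positivity)) (by
      refine h₁₂.imp (fun h n => by simp [M₁, M₂, h]) fun h =>
        ⟨16, (R.1 + R.2) + (ℓ₁ + ℓ₂), by norm_num, fun n => ?_, ?_⟩
      · rw [two_add, two_add, two_add]
        have hMM : (M₁ n : ℝ) * M₂ n - 1 ≤
            (2 * (2 : ℝ) ^ (n * R.1)) * (2 * (2 : ℝ) ^ (n * R.2)) :=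
          (sub_le_self _ zero_le_one).trans
            (mul_le_mul (bM₁ n) (bM₂ n) (by positivity) (by positivity))
        calc ((M₁ n : ℝ) * M₂ n - 1) * L₁ n * L₂ n ≤
              (2 * (2 : ℝ) ^ (n * R.1)) * (2 * (2 : ℝ) ^ (n * R.2)) *
                (2 * (2 : ℝ) ^ (n * ℓ₁)) * (2 * (2 : ℝ) ^ (n * ℓ₂)) :=
              mul_le_mul (mul_le_mul hMM (bL₁ n) (by positivity) (by positivity)) (bL₂ n)
                (by positivity) (by positivity)
          _ = _ := by ring
      · rw [← hB₁₂, hℓ₁, hℓ₂]; linarith)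
  have hcode := fun n => W.exists_code_errorProb_le (n := n) (hpos R.1 n) (hpos R.2 n) (hpos ℓ₁ n)
    (hpos ℓ₂ n) hlam hlam' a (Q₁ := fun j _ => q₁ j) (fun j _ => hq₁0 j) hq₁1
    (Q₂ := fun j _ => q₂ j) (fun j _ => hq₂0 j) hq₂1 (d := fun j => W.metric (a j)) hd
    (fun j s₁ x₁ s₂ x₂ y u v hω => (hdp j (ω := (u, v, x₁, x₂, s₁, s₂, y)) fun h0 => hω (by
      rw [← h0, jointLaw]; ring)).ne') ht₁ ht₂ ht₃ ht₄ ht₅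
  choose c hc using hcode
  refine ⟨hR₁, hR₂, c, squeeze_zero (fun n => W.errorProb_nonneg _) hc ?_⟩
  have lim := (((lim₁.add lim₂).add lim₃).add lim₄).add lim₅
  simp only [add_zero] at lim
  exact lim

end Achievability

end StateMAC

end

/-! ### Passage to the closed convex hull -/

theorem theorem1 {S₁ S₂ X₁ X₂ Y : Type*}
    [Fintype S₁] [Fintype S₂] [Fintype X₁] [Fintype X₂] [Fintype Y]
    (W : StateMAC S₁ S₂ X₁ X₂ Y) :
    W.innerBound ∩ {R | 0 ≤ R.1 ∧ 0 ≤ R.2} ⊆ W.capacityRegion := by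
  rintro R ⟨hR, hR₁, hR₂⟩
  refine Metric.mem_closure_iff.2 fun ε hε => ?_
  obtain ⟨P, hP, hdist⟩ := Metric.mem_closure_iff.1 hR (ε / 8) (by positivity)
  obtain ⟨ι, _, lam, T, hlam, hlam', hT, rfl⟩ := mem_convexHull_iff_exists_fintype.1 hP
  choose k l a ha using hT
  rw [Prod.dist_eq, max_lt_iff, Real.dist_eq, Real.dist_eq, abs_lt, abs_lt] at hdist
  simp only [Prod.fst_sum, Prod.snd_sum, Prod.smul_fst, Prod.smul_snd, smul_eq_mul] at hdist
  -- The hull point loses less than `ε / 8` in each coordinate, so less than `ε / 4` in the sum,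
  -- while any coordinate not truncated to zero backs off by `ε / 2`. A truncated coordinate is a
  -- zero rate and needs no bound of its own, though the hull point may be negative there.
  refine ⟨(max (R.1 - ε / 2) 0, max (R.2 - ε / 2) 0), W.achievable_of_lt hlam hlam' a ha
    (le_max_right _ _) (le_max_right _ _) ?_ ?_ ?_, ?_⟩
  · rcases max_choice (R.1 - ε / 2) 0 with h | h
    · exact Or.inr (by simp only [h]; linarith [hdist.1.2])
    · exact Or.inl h
  · rcases max_choice (R.2 - ε / 2) 0 with h | h
    · exact Or.inr (by simp only [h]; linarith [hdist.2.2])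
    · exact Or.inl h
  · simp only [mul_add, Finset.sum_add_distrib]
    rcases max_choice (R.1 - ε / 2) 0 with h | h <;> rcases max_choice (R.2 - ε / 2) 0 with h' | h'
    · exact Or.inr (by rw [h, h']; linarith [hdist.1.2, hdist.2.2])
    · exact Or.inr (by rw [h, h']; linarith [hdist.1.2, hdist.2.2])
    · exact Or.inr (by rw [h, h']; linarith [hdist.1.2, hdist.2.2])
    · exact Or.inl ⟨h, h'⟩
  · rw [Prod.dist_eq, max_lt_iff, Real.dist_eq, Real.dist_eq, abs_lt, abs_lt]
    refine ⟨⟨?_, ?_⟩, ?_, ?_⟩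
    · have : max (R.1 - ε / 2) 0 ≤ R.1 := max_le (by linarith) hR₁
      simp only; linarith
    · have := le_max_left (R.1 - ε / 2) 0
      simp only; linarith
    · have : max (R.2 - ε / 2) 0 ≤ R.2 := max_le (by linarith) hR₂
      simp only; linarith
    · have := le_max_left (R.2 - ε / 2) 0
      simp only; linarith
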